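/- Let $d\ge 1$, $p\in\mathbb N_0$, and let $\Omega\subset\mathbb R^d$ be open and bounded (for instance a bounded Lipschitz domain). Let $0<\alpha\le\beta<\infty$ and let $\sigma,\kappa$ be real constants. Then there are constants $c,C>0$, depending only on $d,p,\Omega,\alpha,\beta,\sigma,\kappa$, such that the following holds. Let $A:\Omega\to\mathbb R$ be measurable with $\alpha\le A(x)\le\beta$ for a.e. $x\in\Omega$. Let $\mathcal T_H$ be a finite decomposition of $\Omega$ into closed axis-parallel $d$-rectangles $K=\prod_{i=1}^d[l_i,u_i]$ with $l_i<u_i$, that is, $\overline\Omega=\bigcup_{K\in\mathcal T_H}K$, the interiors of the elements lie in $\Omega$, and the interiors of distinct elements are disjoint. Assume that $\mathcal T_H$ is shape regular, $\operatorname{diam}K\le\sigma\min_i(u_i-l_i)$ for all $K\in\mathcal T_H$, and quasi-uniform with mesh size $H>0$, $\operatorname{diam}K\le H\le\kappa\operatorname{diam}K$ for all $K\in\mathcal T_H$. Let $V_H\subset L^2(\Omega)$ be the space of functions that on each $K\in\mathcal T_H$ agree with a polynomial of degree at most $p$ in each variable, let $\Pi_H$ be the $L^2(\Omega)$-orthogonal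 projection onto $V_H$, and let $$W=\{w\in H^1_0(\Omega):\Pi_Hw=0\},\qquad a(u,w)=\int_\Omega A\,\nabla u\cdot\nabla w\,dx.$$ For $S\subset\mathbb R^d$ let $\mathtt N(S)=\bigcup\{K\in\mathcal T_H: \overline S\cap K\ne\emptyset\}$, and let $\mathtt N^1(S)=\mathtt N(S)$ and $\mathtt N^{\lambda}(S)=\mathtt N(\mathtt N^{\lambda-1}(S))$ for $\lambda\ge2$. Then for every $G\in\mathcal T_H$ and $v\in L^2(\Omega)$ there is a unique $\mathcal D_Gv\in W$ (the global element-wise enriched correction) with $$a(\mathcal D_Gv,w)=-(v,w)_{L^2(G)}\qquad\text{for all }w\in W,$$ and it satisfies, for every integer $\lambda\ge1$, $$\|\nabla\mathcal D_Gv\|_{L^2(\Omega\setminus\mathtt N^{\lambda}(G))}\le C\,e^{-c\lambda}\,\|\nabla\mathcal D_Gv\|_{L^2(\Omega)}.$$ In particular, $c$ and $C$ do not depend on $H$, $\lambda$, $\mathcal T_H$, $G$, $v$, or on $A$ other than through $\alpha$ and $\beta$. -/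

import Mathlib

open MeasureTheory Set
open scoped ContDiff Gradient

namespace LOD

/-! ### Meshes of `d`-rectangles -/

/-- A nondegenerate axis-parallel `d`-rectangle `∏ i, [lower i, upper i]`. -/
structure Rect (d : ℕ) where
  lower : Fin d → ℝ
  upper : Fin d → ℝ
  lower_lt_upper : ∀ i, lower i < upper i

/-- The closed `d`-rectangle as a set of points. -/
def Rect.closed {d : ℕ} (K : Rect d) : Set (EuclideanSpace ℝ (Fin d)) :=
  {x | ∀ i, x i ∈ Icc (K.lower i) (K.upper i)}

/-- The interior of the `d`-rectangle. -/
def Rect.inner {d : ℕ} (K : Rect d) : Set (EuclideanSpace ℝ (Fin d)) :=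
  {x | ∀ i, x i ∈ Ioo (K.lower i) (K.upper i)}

/-- A decomposition of `Ω` into finitely many closed `d`-rectangles: they cover the closure of
`Ω`, their interiors lie in `Ω`, and the interiors of distinct elements are disjoint. -/
structure RectMesh {d : ℕ} (Ω : Set (EuclideanSpace ℝ (Fin d))) where
  cells : Finset (Rect d)
  closure_eq : closure Ω = ⋃ K ∈ cells, K.closed
  inner_subset : ∀ K ∈ cells, K.inner ⊆ Ω
  inner_disjoint : ∀ K ∈ cells, ∀ L ∈ cells, K ≠ L → Disjoint K.inner L.inner

/-- Shape regularity with constant `σ`: the diameter of each element is at most `σ` times the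
diameter of its largest inscribed ball, that is, `σ` times each of its side lengths. -/
def RectMesh.ShapeRegular {d : ℕ} {Ω : Set (EuclideanSpace ℝ (Fin d))} (T : RectMesh Ω)
    (σ : ℝ) : Prop :=
  ∀ K ∈ T.cells, ∀ i, Metric.diam K.closed ≤ σ * (K.upper i - K.lower i)

/-- Quasi-uniformity with constant `κ` and mesh size `H`: all diameters lie in `[H / κ, H]`. -/
def RectMesh.QuasiUniform {d : ℕ} {Ω : Set (EuclideanSpace ℝ (Fin d))} (T : RectMesh Ω)
    (κ H : ℝ) : Prop :=
  ∀ K ∈ T.cells, Metric.diam K.closed ≤ H ∧ H ≤ κ * Metric.diam K.closed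

/-- The first-order patch `N(S)`: the union of all elements that touch the closure of `S`. -/
def RectMesh.nbhd {d : ℕ} {Ω : Set (EuclideanSpace ℝ (Fin d))} (T : RectMesh Ω)
    (S : Set (EuclideanSpace ℝ (Fin d))) : Set (EuclideanSpace ℝ (Fin d)) :=
  ⋃ K ∈ {K | K ∈ T.cells ∧ (closure S ∩ K.closed).Nonempty}, K.closed

/-- The patch `N^k(S)` of order `k`: the `k`-fold iterate of `S ↦ N(S)`. -/
def RectMesh.patch {d : ℕ} {Ω : Set (EuclideanSpace ℝ (Fin d))} (T : RectMesh Ω)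
    (k : ℕ) (S : Set (EuclideanSpace ℝ (Fin d))) : Set (EuclideanSpace ℝ (Fin d)) :=
  T.nbhd^[k] S

/-! ### Function spaces -/

/-- `L²(Ω)`. -/
abbrev L2 {d : ℕ} (Ω : Set (EuclideanSpace ℝ (Fin d))) : Type :=
  Lp ℝ 2 (volume.restrict Ω)

/-- Pairs (function, vector field) in `L²(Ω) × L²(Ω)^d` with the Hilbert norm
`(‖u‖² + ‖g‖²)^(1/2)`; a Sobolev function is represented by its pair `(u, ∇u)`. -/
abbrev L2Pair {d : ℕ} (Ω : Set (EuclideanSpace ℝ (Fin d))) : Type :=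
  WithLp 2 (L2 Ω × Lp (EuclideanSpace ℝ (Fin d)) 2 (volume.restrict Ω))

/-- The pairs `(φ, ∇φ)` with `φ` a smooth function compactly supported in `Ω`. -/
noncomputable def testPairs {d : ℕ} (Ω : Set (EuclideanSpace ℝ (Fin d))) : Submodule ℝ (L2Pair Ω) where
  carrier := {z | ∃ φ : EuclideanSpace ℝ (Fin d) → ℝ,
    ContDiff ℝ ∞ φ ∧ HasCompactSupport φ ∧ tsupport φ ⊆ Ω ∧
    z.fst =ᵐ[volume.restrict Ω] φ ∧ z.snd =ᵐ[volume.restrict Ω] ∇ φ}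
  zero_mem' := by
    refine ⟨fun _ => 0, contDiff_const, HasCompactSupport.zero, ?_, ?_, ?_⟩
    · have h : tsupport (fun _ : EuclideanSpace ℝ (Fin d) => (0 : ℝ)) = ∅ := by
        simp [tsupport]
      simp [h]
    · exact Lp.coeFn_zero _ _ _
    · rw [gradient_fun_const']
      exact Lp.coeFn_zero _ _ _
  add_mem' := by
    rintro z w ⟨φ, hφ, hφc, hφs, h1, h2⟩ ⟨ψ, hψ, hψc, hψs, h3, h4⟩
    refine ⟨φ + ψ, hφ.add hψ, hφc.add hψc, ?_, ?_, ?_⟩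
    · exact (tsupport_add φ ψ).trans (union_subset hφs hψs)
    · exact (Lp.coeFn_add _ _).trans (h1.add h3)
    · have hg : ∇ (φ + ψ) = ∇ φ + ∇ ψ := by
        funext x
        have e1 : DifferentiableAt ℝ φ x := (hφ.differentiable (by simp)).differentiableAt
        have e2 : DifferentiableAt ℝ ψ x := (hψ.differentiable (by simp)).differentiableAt
        simp [gradient, fderiv_add e1 e2]
      rw [hg]
      exact (Lp.coeFn_add _ _).trans (h2.add h4)
  smul_mem' := by
    rintro c z ⟨φ, hφ, hφc, hφs, h1, h2⟩
    refine ⟨c • φ, hφ.const_smul c, hφc.smul_left (f := fun _ => c), ?_, ?_, ?_⟩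
    · exact (closure_mono (Function.support_const_smul_subset c φ)).trans hφs
    · exact (Lp.coeFn_smul _ _).trans (h1.const_smul c)
    · have hg : ∇ (c • φ) = c • ∇ φ := by
        funext x
        have e1 : DifferentiableAt ℝ φ x := (hφ.differentiable (by simp)).differentiableAt
        simp [gradient, fderiv_const_smul e1]
      rw [hg]
      exact (Lp.coeFn_smul _ _).trans (h2.const_smul c)

/-- `H¹₀(Ω)`, the closure of the test functions in the `H¹`-norm. An element `u` consists of the
function `u.fst` and its weak gradient `u.snd`. -/
noncomputable def H10 {d : ℕ} (Ω : Set (EuclideanSpace ℝ (Fin d))) : Submodule ℝ (L2Pair Ω) :=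
  (testPairs Ω).topologicalClosure

/-- `V_H`: the functions in `L²(Ω)` that on each element agree with a polynomial of degree at
most `p` in each variable. -/
noncomputable def RectMesh.polySpace {d : ℕ} {Ω : Set (EuclideanSpace ℝ (Fin d))} (T : RectMesh Ω) (p : ℕ) :
    Submodule ℝ (L2 Ω) where
  carrier := {v | ∀ K ∈ T.cells, ∃ q ∈ MvPolynomial.restrictDegree (Fin d) ℝ p,
    v =ᵐ[(volume.restrict Ω).restrict K.closed] fun x => MvPolynomial.eval (fun i => x i) q}
  zero_mem' := fun K _ => ⟨0, zero_mem _, by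
    filter_upwards [ae_restrict_of_ae (Lp.coeFn_zero ℝ 2 (volume.restrict Ω))] with x hx
    rw [hx]
    simp⟩
  add_mem' := by
    intro v w hv hw K hK
    obtain ⟨q, hq, h1⟩ := hv K hK
    obtain ⟨r, hr, h2⟩ := hw K hK
    refine ⟨q + r, add_mem hq hr, ?_⟩
    filter_upwards [ae_restrict_of_ae (Lp.coeFn_add v w), h1, h2] with x hx h1 h2
    rw [hx, Pi.add_apply, h1, h2, map_add]
  smul_mem' := by
    intro c v hv K hK
    obtain ⟨q, hq, h1⟩ := hv K hK
    refine ⟨c • q, Submodule.smul_mem _ _ hq, ?_⟩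
    filter_upwards [ae_restrict_of_ae (Lp.coeFn_smul c v), h1] with x hx h1
    rw [hx, Pi.smul_apply, h1, MvPolynomial.smul_eval, smul_eq_mul]

theorem aestronglyMeasurable_eval {d : ℕ} (μ : Measure (EuclideanSpace ℝ (Fin d)))
    (q : MvPolynomial (Fin d) ℝ) : AEStronglyMeasurable
      (fun x : EuclideanSpace ℝ (Fin d) => MvPolynomial.eval (fun i => x i) q) μ := by
  have h : Continuous fun x : EuclideanSpace ℝ (Fin d) => MvPolynomial.eval (fun i => x i) q :=
    (MvPolynomial.continuous_eval q).comp (by fun_prop)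
  exact h.aestronglyMeasurable

/-- Evaluation of polynomials, as a linear map into classes of a.e. equal functions. -/
noncomputable def polyToAE {d : ℕ} (μ : Measure (EuclideanSpace ℝ (Fin d))) :
    MvPolynomial (Fin d) ℝ →ₗ[ℝ] (EuclideanSpace ℝ (Fin d) →ₘ[μ] ℝ) where
  toFun q := AEEqFun.mk (fun x => MvPolynomial.eval (fun i => x i) q)
    (aestronglyMeasurable_eval μ q)
  map_add' q r := by
    rw [AEEqFun.mk_add_mk]
    congr 1
    funext x
    simp
  map_smul' c q := by
    rw [RingHom.id_apply]
    refine Eq.trans ?_ (AEEqFun.smul_mk c _ (aestronglyMeasurable_eval μ q))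
    congr 1
    funext x
    simp

instance RectMesh.finiteDimensional_polySpace {d : ℕ} {Ω : Set (EuclideanSpace ℝ (Fin d))}
    (T : RectMesh Ω) (p : ℕ) : FiniteDimensional ℝ (T.polySpace p) := by
  classical
  let J : L2 Ω →ₗ[ℝ] (K : T.cells) →
      (EuclideanSpace ℝ (Fin d) →ₘ[(volume.restrict Ω).restrict K.1.closed] ℝ) :=
    LinearMap.pi fun K =>
      (Lp.LpSubmodule ℝ ℝ 2 ((volume.restrict Ω).restrict K.1.closed)).subtype.comp
        (LpToLpRestrictCLM (EuclideanSpace ℝ (Fin d)) ℝ ℝ (volume.restrict Ω) 2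
          K.1.closed).toLinearMap
  have hJval : ∀ v K, J v K =ᵐ[(volume.restrict Ω).restrict K.1.closed] v :=
    fun v K => LpToLpRestrictCLM_coeFn ℝ K.1.closed v
  have hJ : Function.Injective J := by
    rw [← LinearMap.ker_eq_bot, LinearMap.ker_eq_bot']
    intro v hv
    apply Lp.ext
    refine Filter.EventuallyEq.trans ?_ (Lp.coeFn_zero ℝ 2 (volume.restrict Ω)).symm
    have h1 : ∀ K ∈ (T.cells : Set (Rect d)),
        ∀ᵐ x ∂(volume.restrict Ω).restrict K.closed, v x = 0 := by
      intro K hK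
      have h2 := hJval v ⟨K, hK⟩
      rw [hv] at h2
      filter_upwards [h2, AEEqFun.coeFn_zero (β := ℝ)
        (μ := (volume.restrict Ω).restrict K.closed)] with x hx hx'
      rw [← hx]
      exact hx'
    replace h1 := (ae_restrict_biUnion_finset_iff (μ := volume.restrict Ω)
      (fun K : Rect d => K.closed) T.cells (fun x => v x = 0)).2 h1
    have h3 : Ω ⊆ ⋃ K ∈ T.cells, K.closed := T.closure_eq ▸ subset_closure
    have h4 := ae_mono (Measure.restrict_mono_set (volume.restrict Ω) h3) h1
    rw [Measure.restrict_restrict_of_subset subset_rfl] at h4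
    exact h4
  let Φ : ((K : T.cells) → MvPolynomial.restrictDegree (Fin d) ℝ p) →ₗ[ℝ] (K : T.cells) →
      (EuclideanSpace ℝ (Fin d) →ₘ[(volume.restrict Ω).restrict K.1.closed] ℝ) :=
    LinearMap.pi fun K => (polyToAE _).comp
      ((MvPolynomial.restrictDegree (Fin d) ℝ p).subtype.comp (LinearMap.proj K))
  have hle : (T.polySpace p).map J ≤ LinearMap.range Φ := by
    rintro _ ⟨v, hv, rfl⟩
    choose q hq hqv using hv
    refine ⟨fun K => ⟨q K.1 K.2, hq K.1 K.2⟩, ?_⟩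
    funext K
    apply AEEqFun.ext
    exact (AEEqFun.coeFn_mk _ _).trans ((hqv K.1 K.2).symm.trans (hJval v K).symm)
  have : FiniteDimensional ℝ ((T.polySpace p).map J) := Submodule.finiteDimensional_of_le hle
  exact (Submodule.equivMapOfInjective J hJ (T.polySpace p)).symm.finiteDimensional

/-- The `L²`-orthogonal projection onto `V_H`. -/
noncomputable def RectMesh.l2Proj {d : ℕ} {Ω : Set (EuclideanSpace ℝ (Fin d))} (T : RectMesh Ω)
    (p : ℕ) : L2 Ω →L[ℝ] L2 Ω :=
  (T.polySpace p).starProjection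

/-- `W`: the functions in `H¹₀(Ω)` whose `L²`-projection onto `V_H` vanishes. -/
noncomputable def RectMesh.kernelSpace {d : ℕ} {Ω : Set (EuclideanSpace ℝ (Fin d))}
    (T : RectMesh Ω) (p : ℕ) : Submodule ℝ (L2Pair Ω) :=
  H10 Ω ⊓ (LinearMap.ker (T.l2Proj p).toLinearMap).comap (WithLp.fstₗ 2 ℝ _ _)

/-! ### The enriched corrector -/

/-- `a(u, w) = ∫_Ω A ∇u · ∇w`. -/
noncomputable def energyForm {d : ℕ} {Ω : Set (EuclideanSpace ℝ (Fin d))}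
    (A : EuclideanSpace ℝ (Fin d) → ℝ) (u w : L2Pair Ω) : ℝ :=
  ∫ x in Ω, A x * inner ℝ (u.snd x) (w.snd x)

/-- `ψ` is the enriched correction `D_G v` : `ψ ∈ W` and `a(ψ, w) = -(v, w)_{L²(G)}` for all
`w ∈ W`. -/
def RectMesh.IsEnrichedCorrection {d : ℕ} {Ω : Set (EuclideanSpace ℝ (Fin d))} (T : RectMesh Ω)
    (p : ℕ) (A : EuclideanSpace ℝ (Fin d) → ℝ) (G : Rect d) (v : L2 Ω) (ψ : L2Pair Ω) : Prop :=
  ψ ∈ T.kernelSpace p ∧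
    ∀ w ∈ T.kernelSpace p, energyForm A ψ w = -∫ x in Ω ∩ G.closed, v x * w.fst x

/-- `‖∇u‖_{L²(S)}` for a measurable `S ⊆ Ω`. -/
noncomputable def gradNormOn {d : ℕ} {Ω : Set (EuclideanSpace ℝ (Fin d))}
    (S : Set (EuclideanSpace ℝ (Fin d))) (u : L2Pair Ω) : ℝ :=
  Real.sqrt (∫ x in S, ‖u.snd x‖ ^ 2)

end LOD

/-!
The decay follows from a Caccioppoli ("hole filling") argument inside the kernel `W`. Let `η` be a
smooth cutoff that vanishes near `G` and is `1` far from `G`, with gradient of order `1 / H`. The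
function `η ψ` need not lie in `W`, but subtracting on each cell a combination of bubbles dual to
the polynomials of degree at most `p` repairs this without changing it on cells where `η` is
constant. A function of `W` has mean zero on each cell, so the Poincaré inequality bounds `‖ψ‖`
there by `H ‖∇ψ‖`, and the corrected function `w` satisfies `‖∇w‖ ≤ C ‖∇ψ‖` on every cell, with `C`
independent of `H`. Since `a(ψ, w) = 0`, the energy of `ψ` far from `G` is at most a constant times
its energy on the cells where `η` varies. Adding a multiple of the former to both sides shows that
the energy outside the patch contracts by a fixed factor every `2 * 2 ^ d + 1` layers.

A cutoff of width comparable to `H` fits into that many layers because `2 * 2 ^ d` layers around a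
set of cells reach every nearby point of the closure of `Ω`. Indeed, nearby points of this finite
union of rectangles are joined by a path inside it that stays in their bounding box. If the box is
smaller than all cells, each cell that meets it contains one of its `2 ^ d` corners, so cells with a
common corner touch, and every second layer around the starting cells gains a new corner until the
path is covered.
-/

namespace LOD

/-! ### The Poincaré inequality on convex sets -/

section SecondMoment

variable {X : Type*} [MeasurableSpace X] {μ : Measure X} [IsFiniteMeasure μ] {f : X → ℝ}

theorem integrable_sq_sub_prod (hf : MemLp f 2 μ) :
    Integrable (fun z : X × X => (f z.1 - f z.2) ^ 2) (μ.prod μ) :=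
  ((hf.comp_fst μ).sub (hf.comp_snd μ)).integrable_sq

theorem integral_sq_sub_prod (hf : MemLp f 2 μ) :
    ∫ z, (f z.1 - f z.2) ^ 2 ∂μ.prod μ
      = 2 * (μ.real univ * ∫ x, f x ^ 2 ∂μ - (∫ x, f x ∂μ) ^ 2) := by
  have hf1 : Integrable f μ := hf.integrable one_le_two
  have hexpand : ∀ z : X × X, (f z.1 - f z.2) ^ 2 = f z.1 ^ 2 + f z.2 ^ 2 - 2 * (f z.1 * f z.2) :=
    fun z => by ring
  simp_rw [hexpand]
  have hsq_fst : Integrable (fun z : X × X => f z.1 ^ 2) (μ.prod μ) := hf.integrable_sq.comp_fst μ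
  have hsq_snd : Integrable (fun z : X × X => f z.2 ^ 2) (μ.prod μ) := hf.integrable_sq.comp_snd μ
  rw [integral_sub (by fun_prop) ((hf1.mul_prod hf1).const_mul 2), integral_add hsq_fst hsq_snd,
    integral_const_mul, integral_prod_mul, integral_fun_fst fun x => f x ^ 2,
    integral_fun_snd fun x => f x ^ 2]
  simp only [smul_eq_mul]
  ring

theorem sq_integral_le_mul_integral_sq (hf : MemLp f 2 μ) :
    (∫ x, f x ∂μ) ^ 2 ≤ μ.real univ * ∫ x, f x ^ 2 ∂μ := by
  have h : 0 ≤ ∫ z, (f z.1 - f z.2) ^ 2 ∂μ.prod μ := integral_nonneg fun z => sq_nonneg _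
  rw [integral_sq_sub_prod hf] at h
  linarith

end SecondMoment

section Poincare

variable {E : Type*} [NormedAddCommGroup E] [NormedSpace ℝ E]

theorem sq_sub_le_integral_sq_fderiv {φ : E → ℝ} (hφ : ContDiff ℝ 1 φ) (x y : E) :
    (φ x - φ y) ^ 2 ≤ dist x y ^ 2 * ∫ t in Ioc (0 : ℝ) 1, ‖fderiv ℝ φ (y + t • (x - y))‖ ^ 2 := by
  have hfderiv : Continuous fun t : ℝ => fderiv ℝ φ (y + t • (x - y)) :=
    (hφ.continuous_fderiv one_ne_zero).comp (by fun_prop)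
  have hderiv : Continuous fun t : ℝ => fderiv ℝ φ (y + t • (x - y)) (x - y) :=
    hfderiv.clm_apply continuous_const
  have hFTC : ∫ t in Ioc (0 : ℝ) 1, fderiv ℝ φ (y + t • (x - y)) (x - y) = φ x - φ y := by
    have hline : ∀ t ∈ uIcc (0 : ℝ) 1, HasDerivAt (fun t : ℝ => φ (y + t • (x - y)))
        (fderiv ℝ φ (y + t • (x - y)) (x - y)) t := fun t _ =>
      (hφ.differentiable one_ne_zero _).hasFDerivAt.comp_hasDerivAt t
        (by simpa using ((hasDerivAt_id t).smul_const (x - y)).const_add y)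
    rw [← intervalIntegral.integral_of_le zero_le_one,
      intervalIntegral.integral_eq_sub_of_hasDerivAt hline (hderiv.intervalIntegrable _ _)]
    simp
  have hL2 : MemLp (fun t : ℝ => fderiv ℝ φ (y + t • (x - y)) (x - y)) 2
      (volume.restrict (Ioc 0 1)) :=
    (memLp_two_iff_integrable_sq hderiv.aestronglyMeasurable).2 (hderiv.pow 2).integrableOn_Ioc
  calc (φ x - φ y) ^ 2
      ≤ ∫ t in Ioc (0 : ℝ) 1, fderiv ℝ φ (y + t • (x - y)) (x - y) ^ 2 := by
        rw [← hFTC]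
        simpa using sq_integral_le_mul_integral_sq hL2
    _ ≤ ∫ t in Ioc (0 : ℝ) 1, dist x y ^ 2 * ‖fderiv ℝ φ (y + t • (x - y))‖ ^ 2 := by
        refine integral_mono (hderiv.pow 2).integrableOn_Ioc
          (by fun_prop : Continuous _).integrableOn_Ioc fun t => ?_
        simp only
        rw [← mul_pow, ← sq_abs, dist_eq_norm, mul_comm]
        gcongr
        exact (fderiv ℝ φ (y + t • (x - y))).le_opNorm (x - y)
    _ = _ := integral_const_mul _ _

variable [FiniteDimensional ℝ E] [MeasurableSpace E] [BorelSpace E] {μ : Measure E}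
  [μ.IsAddHaarMeasure]

theorem lintegral_comp_add_smul_le {F : E → ENNReal} (hF : Measurable F) (c : E) {t : ℝ}
    (ht : 1 / 2 ≤ t) :
    ∫⁻ x, F (c + t • x) ∂μ ≤ 2 ^ Module.finrank ℝ E * ∫⁻ x, F x ∂μ := by
  have ht0 : 0 < t := by linarith
  have hmap : ∫⁻ x, F (c + t • x) ∂μ = ∫⁻ x, F (c + x) ∂(μ.map fun x => t • x) := by
    rw [lintegral_map (by fun_prop) (by fun_prop)]
  rw [hmap, Measure.map_addHaar_smul _ ht0.ne', lintegral_smul_measure,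
    lintegral_add_left_eq_self, smul_eq_mul]
  gcongr
  refine ENNReal.ofReal_le_of_le_toReal ?_
  rw [ENNReal.toReal_pow, ENNReal.toReal_ofNat, abs_of_pos (by positivity), ← inv_pow]
  gcongr
  rw [inv_le_comm₀ ht0 two_pos]
  linarith

/-- One of the two maps `x ↦ y + t • (x - y)` and `y ↦ y + t • (x - y)` scales lengths by at least
`1 / 2`. -/
theorem lintegral_lintegral_comp_segment_le {F : E → ENNReal} (hF : Measurable F) (s : Set E)
    (t : ℝ) :
    ∫⁻ x in s, ∫⁻ y in s, F (y + t • (x - y)) ∂μ ∂μ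
      ≤ 2 ^ Module.finrank ℝ E * μ s * ∫⁻ z, F z ∂μ := by
  have const_bound : ∀ {G : E → ENNReal},
      (∀ z, G z ≤ 2 ^ Module.finrank ℝ E * ∫⁻ z, F z ∂μ) →
      ∫⁻ z in s, G z ∂μ ≤ 2 ^ Module.finrank ℝ E * μ s * ∫⁻ z, F z ∂μ := fun hG => by
    refine (lintegral_mono hG).trans_eq ?_
    rw [lintegral_const, Measure.restrict_apply_univ]
    ring
  rcases le_total (1 / 2) t with ht | ht
  · rw [lintegral_lintegral_swap
      (f := fun x y => F (y + t • (x - y))) (hF.comp (by fun_prop)).aemeasurable]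
    refine const_bound fun y => (setLIntegral_le_lintegral _ _).trans ?_
    simp_rw [show ∀ x, y + t • (x - y) = (y - t • y) + t • x from fun x => by module]
    exact lintegral_comp_add_smul_le hF _ ht
  · refine const_bound fun x => (setLIntegral_le_lintegral _ _).trans ?_
    simp_rw [show ∀ y, y + t • (x - y) = t • x + (1 - t) • y from fun y => by module]
    exact lintegral_comp_add_smul_le hF _ (by linarith)

theorem lintegral_lintegral_lintegral_segment_le {F : E → ENNReal} (hF : Measurable F)
    (s : Set E) :
    ∫⁻ x in s, ∫⁻ y in s, (∫⁻ t in Ioc (0 : ℝ) 1, F (y + t • (x - y))) ∂μ ∂μ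
      ≤ 2 ^ Module.finrank ℝ E * μ s * ∫⁻ z, F z ∂μ := by
  calc ∫⁻ x in s, ∫⁻ y in s, (∫⁻ t in Ioc (0 : ℝ) 1, F (y + t • (x - y))) ∂μ ∂μ
      = ∫⁻ x in s, (∫⁻ t in Ioc (0 : ℝ) 1, ∫⁻ y in s, F (y + t • (x - y)) ∂μ) ∂μ :=
        lintegral_congr fun x => lintegral_lintegral_swap
          (f := fun y t => F (y + t • (x - y))) (hF.comp (by fun_prop)).aemeasurable
    _ = ∫⁻ t in Ioc (0 : ℝ) 1, ∫⁻ x in s, ∫⁻ y in s, F (y + t • (x - y)) ∂μ ∂μ :=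
        lintegral_lintegral_swap (f := fun x t => ∫⁻ y in s, F (y + t • (x - y)) ∂μ)
          (Measurable.lintegral_prod_right' (f := fun q : (E × ℝ) × E =>
            F (q.2 + q.1.2 • (q.1.1 - q.2))) (hF.comp (by fun_prop))).aemeasurable
    _ ≤ ∫⁻ _ in Ioc (0 : ℝ) 1, 2 ^ Module.finrank ℝ E * μ s * ∫⁻ z, F z ∂μ :=
        lintegral_mono fun t => lintegral_lintegral_comp_segment_le hF s t
    _ = _ := by simp

theorem lintegral_lintegral_sq_sub_le {φ : E → ℝ} (hφ : ContDiff ℝ 1 φ) {s : Set E}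
    (hsm : MeasurableSet s) (hsc : Convex ℝ s) (hsb : Bornology.IsBounded s) :
    ∫⁻ x in s, ∫⁻ y in s, ENNReal.ofReal ((φ x - φ y) ^ 2) ∂μ ∂μ
      ≤ ENNReal.ofReal (Metric.diam s ^ 2) * (2 ^ Module.finrank ℝ E * μ s *
        ∫⁻ z in s, ENNReal.ofReal (‖fderiv ℝ φ z‖ ^ 2) ∂μ) := by
  have hcont : Continuous fun z => ‖fderiv ℝ φ z‖ ^ 2 :=
    (hφ.continuous_fderiv one_ne_zero).norm.pow 2
  set F : E → ENNReal := s.indicator fun z => ENNReal.ofReal (‖fderiv ℝ φ z‖ ^ 2) with hF_def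
  have hF : Measurable F := (ENNReal.measurable_ofReal.comp hcont.measurable).indicator hsm
  have pointwise : ∀ x ∈ s, ∀ y ∈ s, ENNReal.ofReal ((φ x - φ y) ^ 2)
      ≤ ENNReal.ofReal (Metric.diam s ^ 2) * ∫⁻ t in Ioc (0 : ℝ) 1, F (y + t • (x - y)) := by
    intro x hx y hy
    have hsegment : ∫⁻ t in Ioc (0 : ℝ) 1, F (y + t • (x - y))
        = ENNReal.ofReal (∫ t in Ioc (0 : ℝ) 1, ‖fderiv ℝ φ (y + t • (x - y))‖ ^ 2) := by
      rw [ofReal_integral_eq_lintegral_ofReal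
        (by fun_prop : Continuous fun t : ℝ => ‖fderiv ℝ φ (y + t • (x - y))‖ ^ 2).integrableOn_Ioc
        (.of_forall fun t => by positivity)]
      refine setLIntegral_congr_fun measurableSet_Ioc fun t ht => ?_
      exact indicator_of_mem (hsc.add_smul_sub_mem hy hx (Ioc_subset_Icc_self ht)) _
    rw [hsegment, ← ENNReal.ofReal_mul (by positivity)]
    refine ENNReal.ofReal_le_ofReal ((sq_sub_le_integral_sq_fderiv hφ x y).trans ?_)
    gcongr
    exact Metric.dist_le_diam_of_mem hsb hx hy
  calc ∫⁻ x in s, ∫⁻ y in s, ENNReal.ofReal ((φ x - φ y) ^ 2) ∂μ ∂μ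
      ≤ ∫⁻ x in s, ∫⁻ y in s, ENNReal.ofReal (Metric.diam s ^ 2) *
          (∫⁻ t in Ioc (0 : ℝ) 1, F (y + t • (x - y))) ∂μ ∂μ :=
        setLIntegral_mono' hsm fun x hx => setLIntegral_mono' hsm (pointwise x hx)
    _ = ENNReal.ofReal (Metric.diam s ^ 2) *
          ∫⁻ x in s, ∫⁻ y in s, (∫⁻ t in Ioc (0 : ℝ) 1, F (y + t • (x - y))) ∂μ ∂μ := by
        simp_rw [lintegral_const_mul' _ _ ENNReal.ofReal_ne_top]
    _ ≤ ENNReal.ofReal (Metric.diam s ^ 2) *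
          (2 ^ Module.finrank ℝ E * μ s * ∫⁻ z, F z ∂μ) := by
        gcongr
        exact lintegral_lintegral_lintegral_segment_le hF s
    _ = _ := by rw [hF_def, lintegral_indicator hsm]

/-- The variance of `φ` on `s` is half the average of `(φ x - φ y) ^ 2`, which is bounded by
integrating the derivative along the segments of `s`. -/
theorem poincare_of_contDiff {φ : E → ℝ} (hφ : ContDiff ℝ 1 φ) {s : Set E}
    (hsm : MeasurableSet s) (hsc : Convex ℝ s) (hsb : Bornology.IsBounded s) :
    μ.real s * (∫ x in s, φ x ^ 2 ∂μ) - (∫ x in s, φ x ∂μ) ^ 2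
      ≤ 2 ^ Module.finrank ℝ E * Metric.diam s ^ 2 * μ.real s *
        ∫ x in s, ‖fderiv ℝ φ x‖ ^ 2 ∂μ := by
  have hfin : μ s ≠ ⊤ := hsb.measure_lt_top.ne
  have : IsFiniteMeasure (μ.restrict s) := isFiniteMeasure_restrict.2 hfin
  have hint : ∀ {f : E → ℝ}, Continuous f → IntegrableOn f s μ := fun hf =>
    (hf.continuousOn.integrableOn_compact hsb.isCompact_closure).mono_set subset_closure
  have hL2 : MemLp φ 2 (μ.restrict s) :=
    (memLp_two_iff_integrable_sq hφ.continuous.aestronglyMeasurable).2 (hint (hφ.continuous.pow 2))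
  have hcont : Continuous fun z => ‖fderiv ℝ φ z‖ ^ 2 :=
    (hφ.continuous_fderiv one_ne_zero).norm.pow 2
  have hfderiv : 0 ≤ ∫ x in s, ‖fderiv ℝ φ x‖ ^ 2 ∂μ := integral_nonneg fun x => by positivity
  have hle := lintegral_lintegral_sq_sub_le (μ := μ) hφ hsm hsc hsb
  rw [← lintegral_prod (fun z : E × E => ENNReal.ofReal ((φ z.1 - φ z.2) ^ 2))
      (by have := hφ.continuous; fun_prop),
    ← ofReal_integral_eq_lintegral_ofReal (integrable_sq_sub_prod hL2)
      (.of_forall fun z => sq_nonneg _), integral_sq_sub_prod hL2,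
    ← ofReal_integral_eq_lintegral_ofReal (hint hcont) (.of_forall fun x => by positivity),
    ENNReal.ofReal_le_iff_le_toReal (by finiteness)] at hle
  simp only [ENNReal.toReal_mul, ENNReal.toReal_pow, ENNReal.toReal_ofNat,
    measureReal_restrict_apply_univ, ENNReal.toReal_ofReal hfderiv,
    ENNReal.toReal_ofReal (sq_nonneg (Metric.diam s))] at hle
  change _ ≤ _ * (_ * μ.real s * _) at hle
  have hnonneg : 0 ≤ Metric.diam s ^ 2 * (2 ^ Module.finrank ℝ E * μ.real s *
      ∫ x in s, ‖fderiv ℝ φ x‖ ^ 2 ∂μ) := by positivity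
  linarith

end Poincare

/-! ### Smooth cutoff functions -/

section Cutoff

variable {E : Type*} [NormedAddCommGroup E] [NormedSpace ℝ E] [FiniteDimensional ℝ E]

theorem lipschitzWith_normed_convolution [MeasurableSpace E] [BorelSpace E] (μ : Measure E)
    [μ.IsAddHaarMeasure] (φ : ContDiffBump (0 : E)) {f : E → ℝ} {C : NNReal}
    (hf : LipschitzWith C f) :
    LipschitzWith C (convolution (φ.normed μ) f (ContinuousLinearMap.lsmul ℝ ℝ) μ) := by
  have hφ : Continuous (φ.normed μ) := φ.continuous_normed
  have hfc : Continuous f := hf.continuous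
  have hint : ∀ x, Integrable (fun t => φ.normed μ t * f (x - t)) μ := fun x =>
    (hφ.mul (by fun_prop)).integrable_of_hasCompactSupport φ.hasCompactSupport_normed.mul_right
  refine LipschitzWith.of_dist_le_mul fun x y => ?_
  simp only [dist_eq_norm, convolution_def, ContinuousLinearMap.lsmul_apply, smul_eq_mul]
  rw [← integral_sub (hint x) (hint y)]
  calc ‖∫ t, (φ.normed μ t * f (x - t) - φ.normed μ t * f (y - t)) ∂μ‖
      ≤ ∫ t, φ.normed μ t * (C * ‖x - y‖) ∂μ := by
        refine norm_integral_le_of_norm_le (φ.integrable_normed.mul_const _)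
          (Filter.Eventually.of_forall fun t => ?_)
        rw [← mul_sub, norm_mul, Real.norm_of_nonneg (φ.nonneg_normed t)]
        refine mul_le_mul_of_nonneg_left ?_ (φ.nonneg_normed t)
        simpa [dist_eq_norm] using hf.dist_le_mul (x - t) (y - t)
    _ = C * ‖x - y‖ := by rw [integral_mul_const, φ.integral_normed, one_mul]

theorem exists_smooth_cutoff (S : Set E) {ρ : ℝ} (hρ : 0 < ρ) :
    ∃ η : E → ℝ, ContDiff ℝ ∞ η ∧ (∀ x, |η x| ≤ 1) ∧ (∀ x ∈ S, η x = 1) ∧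
      (∀ x ∉ Metric.thickening ρ S, η x = 0) ∧ ∀ x, ‖fderiv ℝ η x‖ ≤ 2 / ρ := by
  borelize E
  let μ : Measure E := Measure.addHaar
  have hρ2 : 0 < ρ / 2 := half_pos hρ
  let f : E → ℝ := fun x => thickenedIndicator hρ2 (Metric.thickening (ρ / 4) S) x
  have hf : LipschitzWith (ρ / 2).toNNReal⁻¹ f := lipschitzWith_thickenedIndicator hρ2 _
  have hf1 : ∀ x, f x ≤ 1 := fun x => thickenedIndicator_le_one hρ2 _ x
  let φ : ContDiffBump (0 : E) := ⟨ρ / 8, ρ / 4, by positivity, by linarith⟩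
  let η := convolution (φ.normed μ) f (ContinuousLinearMap.lsmul ℝ ℝ) μ
  have hη_eq : ∀ x a, (∀ y ∈ Metric.ball x (ρ / 4), f y = a) → η x = a := by
    intro x a hfa
    have hx : f x = a := hfa x (Metric.mem_ball_self (by positivity))
    exact (φ.normed_convolution_eq_right fun y hy => (hfa y hy).trans hx.symm).trans hx
  refine ⟨η, φ.hasCompactSupport_normed.contDiff_convolution_left _ φ.contDiff_normed
    hf.continuous.locallyIntegrable, fun x => ?_, fun x hx => hη_eq x 1 fun y hy => ?_,
    fun x hx => hη_eq x 0 fun y hy => ?_, fun x => ?_⟩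
  · rw [← Real.dist_0_eq_abs]
    refine dist_convolution_le zero_le_one φ.support_normed_eq.subset φ.nonneg_normed
      φ.integral_normed hf.continuous.aestronglyMeasurable fun y _ => ?_
    rw [Real.dist_0_eq_abs, abs_of_nonneg (NNReal.coe_nonneg _)]
    exact hf1 y
  · have hyS : y ∈ Metric.thickening (ρ / 4) S :=
      Metric.mem_thickening_iff.2 ⟨x, hx, Metric.mem_ball.1 hy⟩
    exact congrArg NNReal.toReal (thickenedIndicator_one hρ2 _ hyS)
  · have hyS : y ∉ Metric.thickening (ρ / 2) (Metric.thickening (ρ / 4) S) := fun hyS => by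
      obtain ⟨z, hz, hyz⟩ := Metric.mem_thickening_iff.1 hyS
      obtain ⟨s, hs, hzs⟩ := Metric.mem_thickening_iff.1 hz
      refine hx (Metric.mem_thickening_iff.2 ⟨s, hs, ?_⟩)
      linarith [dist_triangle x y s, dist_triangle y z s, Metric.mem_ball'.1 hy]
    exact congrArg NNReal.toReal (thickenedIndicator_zero hρ2 _ hyS)
  · have h := norm_fderiv_le_of_lipschitz ℝ (lipschitzWith_normed_convolution μ φ hf) (x₀ := x)
    rwa [NNReal.coe_inv, Real.coe_toNNReal _ hρ2.le, inv_div] at h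

end Cutoff

theorem exists_clm_coeFn_eq_bilin {X E F G : Type*} [MeasurableSpace X] {μ : Measure X}
    [NormedAddCommGroup E] [NormedSpace ℝ E] [NormedAddCommGroup F] [NormedSpace ℝ F]
    [NormedAddCommGroup G] [NormedSpace ℝ G] (B : E →L[ℝ] F →L[ℝ] G) {a : X → E}
    (ha : MemLp a ⊤ μ) :
    ∃ M : Lp F 2 μ →L[ℝ] Lp G 2 μ, ∀ u, M u =ᵐ[μ] fun x => B (a x) (u x) := by
  refine ⟨B.holderL μ ⊤ 2 2 ha.toLp, fun u => ?_⟩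
  filter_upwards [B.coeFn_holder (r := 2) ha.toLp u, ha.coeFn_toLp] with x h₁ h₂
  rw [← h₂]
  exact h₁

/-! ### Test functions -/

section TestFunctions

variable {E : Type*} [NormedAddCommGroup E] [NormedSpace ℝ E]

/-- The smooth functions with compact support in `U`. -/
def testFunctions (U : Set E) : Submodule ℝ (E → ℝ) where
  carrier := {φ | ContDiff ℝ ∞ φ ∧ HasCompactSupport φ ∧ tsupport φ ⊆ U}
  zero_mem' := ⟨contDiff_const, HasCompactSupport.zero, by simp [tsupport]⟩
  add_mem' := by
    rintro φ ψ ⟨hφ, hφc, hφU⟩ ⟨hψ, hψc, hψU⟩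
    exact ⟨hφ.add hψ, hφc.add hψc, (tsupport_add φ ψ).trans (union_subset hφU hψU)⟩
  smul_mem' := by
    rintro c φ ⟨hφ, hφc, hφU⟩
    exact ⟨hφ.const_smul c, hφc.smul_left (f := fun _ => c),
      (closure_mono (Function.support_const_smul_subset c φ)).trans hφU⟩

variable [MeasurableSpace E] [BorelSpace E] {μ : Measure E}

theorem integrable_testFunction_mul [IsFiniteMeasureOnCompacts μ] {U : Set E} {φ : E → ℝ}
    (hφ : φ ∈ testFunctions U) {g : E → ℝ} (hg : Continuous g) :
    Integrable (fun x => φ x * g x) μ :=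
  (hφ.1.continuous.mul hg).integrable_of_hasCompactSupport hφ.2.1.mul_right

theorem eqOn_zero_of_integral_testFunction_mul_eq_zero [FiniteDimensional ℝ E]
    [IsFiniteMeasureOnCompacts μ] [μ.IsOpenPosMeasure] {U : Set E} (hU : IsOpen U) {g : E → ℝ}
    (hg : Continuous g) (h : ∀ φ ∈ testFunctions U, ∫ x, φ x * g x ∂μ = 0) :
    EqOn g 0 U := by
  have hae := hU.ae_eq_zero_of_integral_contDiff_smul_eq_zero
    (hg.locallyIntegrable (μ := μ) |>.locallyIntegrableOn U) fun φ h₁ h₂ h₃ => h φ ⟨h₁, h₂, h₃⟩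
  exact Measure.eqOn_open_of_ae_eq ((ae_restrict_iff' hU.measurableSet).2 hae) hU
    hg.continuousOn continuousOn_const

/-- The integrals of test functions on `U` against a finite family of functions. -/
noncomputable def testMoments {ι : Type*} (μ : Measure E) [IsFiniteMeasureOnCompacts μ] (U : Set E)
    {g : ι → E → ℝ} (hg : ∀ i, Continuous (g i)) : testFunctions U →ₗ[ℝ] ι → ℝ where
  toFun φ i := ∫ x, φ.1 x * g i x ∂μ
  map_add' φ ψ := by
    funext i
    simp only [Submodule.coe_add, Pi.add_apply, add_mul]
    exact integral_add (integrable_testFunction_mul φ.2 (hg i))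
      (integrable_testFunction_mul ψ.2 (hg i))
  map_smul' c φ := by
    funext i
    simp only [Submodule.coe_smul, Pi.smul_apply, smul_eq_mul, mul_assoc, RingHom.id_apply]
    exact integral_const_mul _ _

theorem range_testMoments_eq_top [FiniteDimensional ℝ E] [IsFiniteMeasureOnCompacts μ]
    [μ.IsOpenPosMeasure] {ι : Type*} [Fintype ι] {U : Set E} (hU : IsOpen U) {g : ι → E → ℝ}
    (hg : ∀ i, Continuous (g i))
    (hind : ∀ c : ι → ℝ, (∀ x ∈ U, ∑ i, c i * g i x = 0) → c = 0) :
    LinearMap.range (testMoments μ U hg) = ⊤ := by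
  classical
  by_contra hne
  obtain ⟨f, hf0, hf⟩ := Submodule.exists_le_ker_of_lt_top _ (lt_top_iff_ne_top.2 hne)
  let c : ι → ℝ := fun i => f (Pi.single i 1)
  have hfc : ∀ v, f v = ∑ i, v i * c i := fun v => by
    conv_lhs => rw [← Finset.univ_sum_single v, map_sum]
    refine Finset.sum_congr rfl fun i _ => ?_
    rw [← smul_eq_mul, ← map_smul, ← Pi.single_smul', smul_eq_mul, mul_one]
  have horth : ∀ φ ∈ testFunctions U, ∫ x, φ x * ∑ i, c i * g i x ∂μ = 0 := by
    intro φ hφ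
    have hker : f (testMoments μ U hg ⟨φ, hφ⟩) = 0 := hf ⟨_, rfl⟩
    rw [← hker, hfc]
    simp only [Finset.mul_sum, mul_left_comm (φ _)]
    rw [integral_finsetSum _ fun i _ => (integrable_testFunction_mul hφ (hg i)).const_mul _]
    refine Finset.sum_congr rfl fun i _ => ?_
    rw [integral_const_mul, mul_comm]
    rfl
  have hc : c = 0 := hind c fun x hx =>
    eqOn_zero_of_integral_testFunction_mul_eq_zero hU (by fun_prop) horth hx
  exact hf0 (LinearMap.ext fun v => by simp [hfc, hc])

theorem exists_dual_testFunctions [FiniteDimensional ℝ E] [IsFiniteMeasureOnCompacts μ]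
    [μ.IsOpenPosMeasure] {ι : Type*} [Fintype ι] [DecidableEq ι] {U : Set E} (hU : IsOpen U)
    {g : ι → E → ℝ} (hg : ∀ i, Continuous (g i))
    (hind : ∀ c : ι → ℝ, (∀ x ∈ U, ∑ i, c i * g i x = 0) → c = 0) :
    ∃ b : ι → E → ℝ, (∀ j, b j ∈ testFunctions U) ∧
      ∀ i j, ∫ x, b j x * g i x ∂μ = if i = j then 1 else 0 := by
  choose b hb using fun j =>
    LinearMap.range_eq_top.1 (range_testMoments_eq_top (μ := μ) hU hg hind) (Pi.single j 1)
  refine ⟨fun j => (b j).1, fun j => (b j).2, fun i j => ?_⟩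
  rw [← Pi.single_apply]
  exact congrFun (hb j) i

end TestFunctions

/-! ### Rectangles -/

section Rectangles

variable {d : ℕ}

theorem Rect.side_pos (K : Rect d) (i : Fin d) : 0 < K.upper i - K.lower i :=
  sub_pos.2 (K.lower_lt_upper i)

theorem Rect.inner_subset_closed (K : Rect d) : K.inner ⊆ K.closed :=
  fun _ hx i => Ioo_subset_Icc_self (hx i)

theorem Rect.closed_eq_preimage (K : Rect d) :
    K.closed = EuclideanSpace.equiv (Fin d) ℝ ⁻¹' univ.pi fun i => Icc (K.lower i) (K.upper i) := by
  ext x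
  exact mem_univ_pi.symm

theorem Rect.inner_eq_preimage (K : Rect d) :
    K.inner = EuclideanSpace.equiv (Fin d) ℝ ⁻¹' univ.pi fun i => Ioo (K.lower i) (K.upper i) := by
  ext x
  exact mem_univ_pi.symm

theorem Rect.isCompact_closed (K : Rect d) : IsCompact K.closed := by
  rw [K.closed_eq_preimage]
  exact (EuclideanSpace.equiv (Fin d) ℝ).toHomeomorph.isCompact_preimage.2
    (isCompact_univ_pi fun _ => isCompact_Icc)

theorem Rect.isClosed_closed (K : Rect d) : IsClosed K.closed :=
  K.isCompact_closed.isClosed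

theorem Rect.isOpen_inner (K : Rect d) : IsOpen K.inner := by
  rw [K.inner_eq_preimage]
  exact (isOpen_set_pi finite_univ fun i _ => isOpen_Ioo).preimage
    (EuclideanSpace.equiv (Fin d) ℝ).continuous

theorem Rect.measurableSet_inner (K : Rect d) : MeasurableSet K.inner :=
  K.isOpen_inner.measurableSet

theorem Rect.convex_inner (K : Rect d) : Convex ℝ K.inner := by
  rw [K.inner_eq_preimage]
  exact (convex_pi fun i _ => convex_Ioo _ _).linear_preimage
    (EuclideanSpace.equiv (Fin d) ℝ).toLinearEquiv.toLinearMap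

theorem Rect.convex_closed (K : Rect d) : Convex ℝ K.closed := by
  rw [K.closed_eq_preimage]
  exact (convex_pi fun i _ => convex_Icc _ _).linear_preimage
    (EuclideanSpace.equiv (Fin d) ℝ).toLinearEquiv.toLinearMap

theorem Rect.inner_nonempty (K : Rect d) : K.inner.Nonempty :=
  ⟨WithLp.toLp 2 fun i => (K.lower i + K.upper i) / 2, fun i =>
    ⟨left_lt_add_div_two.2 (K.lower_lt_upper i), add_div_two_lt_right.2 (K.lower_lt_upper i)⟩⟩

theorem Rect.closed_nonempty (K : Rect d) : K.closed.Nonempty :=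
  K.inner_nonempty.mono K.inner_subset_closed

theorem Rect.inner_ae_eq_closed (K : Rect d) : K.inner =ᵐ[volume] K.closed := by
  rw [K.closed_eq_preimage, K.inner_eq_preimage, pi_univ_Icc]
  exact (PiLp.volume_preserving_ofLp (Fin d)).quasiMeasurePreserving.preimage_ae_eq
    Measure.univ_pi_Ioo_ae_eq_Icc

theorem Rect.volume_real_inner (K : Rect d) :
    volume.real K.inner = ∏ i, (K.upper i - K.lower i) := by
  rw [K.inner_eq_preimage, measureReal_def]
  refine (congrArg ENNReal.toReal ((PiLp.volume_preserving_ofLp (Fin d)).measure_preimage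
    (MeasurableSet.univ_pi fun _ => measurableSet_Ioo).nullMeasurableSet)).trans ?_
  exact Real.volume_pi_Ioo_toReal fun i => (K.lower_lt_upper i).le

theorem Rect.volume_real_inner_pos (K : Rect d) : 0 < volume.real K.inner := by
  rw [K.volume_real_inner]
  exact Finset.prod_pos fun i _ => K.side_pos i

theorem Rect.isBounded_inner (K : Rect d) : Bornology.IsBounded K.inner :=
  K.isCompact_closed.isBounded.subset K.inner_subset_closed

theorem Rect.diam_inner_le (K : Rect d) : Metric.diam K.inner ≤ Metric.diam K.closed :=
  Metric.diam_mono K.inner_subset_closed K.isCompact_closed.isBounded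

instance Rect.isFiniteMeasure_restrict_inner (K : Rect d) :
    IsFiniteMeasure (volume.restrict K.inner) :=
  isFiniteMeasure_restrict.2 K.isBounded_inner.measure_lt_top.ne

end Rectangles

/-! ### Monomials on the unit cube and the affine map onto it -/

section UnitCube

variable {d : ℕ}

/-- The unit cube, the reference element of the scaling arguments. -/
def unitRect (d : ℕ) : Rect d := ⟨fun _ => 0, fun _ => 1, fun _ => zero_lt_one⟩

/-- The monomial with exponents `I`; these span the polynomials of degree at most `p` in each
variable. -/
def mono {p : ℕ} (I : Fin d → Fin (p + 1)) (x : EuclideanSpace ℝ (Fin d)) : ℝ :=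
  ∏ i, x i ^ (I i : ℕ)

theorem continuous_mono {p : ℕ} (I : Fin d → Fin (p + 1)) : Continuous (mono I) := by
  unfold mono
  fun_prop

theorem abs_mono_le_one {p : ℕ} (I : Fin d → Fin (p + 1)) {x : EuclideanSpace ℝ (Fin d)}
    (hx : x ∈ (unitRect d).inner) : |mono I x| ≤ 1 := by
  rw [mono, Finset.abs_prod]
  refine Finset.prod_le_one (fun i _ => abs_nonneg _) fun i _ => ?_
  rw [abs_pow, abs_of_pos (hx i).1]
  exact pow_le_one₀ (hx i).1.le (hx i).2.le

theorem coeff_eq_zero_of_sum_mono_eq_zero {p : ℕ} (c : (Fin d → Fin (p + 1)) → ℝ)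
    (h : ∀ x ∈ (unitRect d).inner, ∑ I, c I * mono I x = 0) : c = 0 := by
  classical
  let e : (Fin d → Fin (p + 1)) → (Fin d →₀ ℕ) := fun I =>
    Finsupp.equivFunOnFinite.symm fun i => (I i : ℕ)
  have he : Function.Injective e := fun I J hIJ => funext fun i =>
    Fin.ext (congrFun (Finsupp.equivFunOnFinite.symm.injective hIJ) i)
  let q : MvPolynomial (Fin d) ℝ := ∑ I, MvPolynomial.monomial (e I) (c I)
  have hq : q = 0 := by
    refine MvPolynomial.funext_set (fun _ => Ioo (0 : ℝ) 1)
      (fun _ => Ioo_infinite zero_lt_one) fun x hx => ?_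
    rw [map_zero, map_sum, ← h (WithLp.toLp 2 x) fun i => hx i (mem_univ i)]
    refine Finset.sum_congr rfl fun I _ => ?_
    rw [MvPolynomial.eval_monomial, Finsupp.prod_fintype _ _ (by simp)]
    rfl
  funext I
  calc c I = q.coeff (e I) := by
        simp [q, MvPolynomial.coeff_sum, MvPolynomial.coeff_monomial, he.eq_iff]
    _ = 0 := by rw [hq, MvPolynomial.coeff_zero]

/-- The linear part of the affine map of `K` onto the unit cube. -/
noncomputable def Rect.scale (K : Rect d) :
    EuclideanSpace ℝ (Fin d) ≃ₗ[ℝ] EuclideanSpace ℝ (Fin d) where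
  toFun x := WithLp.toLp 2 fun i => x i / (K.upper i - K.lower i)
  invFun x := WithLp.toLp 2 fun i => x i * (K.upper i - K.lower i)
  map_add' x y := by ext i; simp [add_div]
  map_smul' c x := by ext i; simp [mul_div_assoc]
  left_inv x := by ext i; simp [div_mul_cancel₀ _ (K.side_pos i).ne']
  right_inv x := by ext i; simp [mul_div_cancel_right₀ _ (K.side_pos i).ne']

/-- The affine map of `K` onto the unit cube. -/
noncomputable def Rect.toUnit (K : Rect d) :
    EuclideanSpace ℝ (Fin d) ≃ₜ EuclideanSpace ℝ (Fin d) :=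
  (Homeomorph.addRight (-WithLp.toLp 2 K.lower)).trans
    K.scale.toContinuousLinearEquiv.toHomeomorph

theorem Rect.toUnit_apply (K : Rect d) (x : EuclideanSpace ℝ (Fin d)) (i : Fin d) :
    K.toUnit x i = (x i - K.lower i) / (K.upper i - K.lower i) := by
  simp [Rect.toUnit, Rect.scale, sub_eq_add_neg]

theorem Rect.toUnit_mem_inner_unitRect_iff (K : Rect d) {x : EuclideanSpace ℝ (Fin d)} :
    K.toUnit x ∈ (unitRect d).inner ↔ x ∈ K.inner := by
  refine forall_congr' fun i => ?_
  simp only [K.toUnit_apply, unitRect, mem_Ioo, div_pos_iff_of_pos_right (K.side_pos i),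
    div_lt_one (K.side_pos i), sub_pos, sub_lt_sub_iff_right]

theorem Rect.norm_scale_le (K : Rect d) {h : ℝ} (hh : 0 < h)
    (hK : ∀ i, h ≤ K.upper i - K.lower i) (x : EuclideanSpace ℝ (Fin d)) :
    ‖K.scale x‖ ≤ h⁻¹ * ‖x‖ := by
  rw [← Real.norm_of_nonneg (inv_nonneg.2 hh.le), ← norm_smul, EuclideanSpace.norm_eq,
    EuclideanSpace.norm_eq]
  gcongr with i
  simp only [Rect.scale, LinearEquiv.coe_mk, LinearMap.coe_mk, AddHom.coe_mk, PiLp.smul_apply,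
    smul_eq_mul, norm_mul, div_eq_inv_mul, norm_inv]
  rw [Real.norm_of_nonneg (K.side_pos i).le, Real.norm_of_nonneg hh.le]
  gcongr
  exact hK i

theorem Rect.hasFDerivAt_toUnit (K : Rect d) (x : EuclideanSpace ℝ (Fin d)) :
    HasFDerivAt K.toUnit
      (K.scale.toContinuousLinearEquiv : EuclideanSpace ℝ (Fin d) →L[ℝ] _) x :=
  K.scale.toContinuousLinearEquiv.hasFDerivAt.comp x ((hasFDerivAt_id x).add_const _)

theorem Rect.contDiff_toUnit (K : Rect d) : ContDiff ℝ ∞ K.toUnit :=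
  K.scale.toContinuousLinearEquiv.contDiff.comp (contDiff_id.add contDiff_const)

theorem Rect.norm_fderiv_comp_toUnit_le (K : Rect d) {h : ℝ} (hh : 0 < h)
    (hK : ∀ i, h ≤ K.upper i - K.lower i) {φ : EuclideanSpace ℝ (Fin d) → ℝ}
    (hφ : Differentiable ℝ φ) {M : ℝ} (hM : ∀ x, ‖fderiv ℝ φ x‖ ≤ M)
    (x : EuclideanSpace ℝ (Fin d)) : ‖fderiv ℝ (φ ∘ K.toUnit) x‖ ≤ M * h⁻¹ := by
  rw [((hφ (K.toUnit x)).hasFDerivAt.comp x (K.hasFDerivAt_toUnit x)).fderiv]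
  refine (ContinuousLinearMap.opNorm_comp_le _ _).trans ?_
  have hM0 : 0 ≤ M := (norm_nonneg _).trans (hM x)
  gcongr
  · exact hM _
  · exact ContinuousLinearMap.opNorm_le_bound _ (by positivity) (K.norm_scale_le hh hK)

theorem Rect.exists_integral_comp_toUnit_eq_mul (K : Rect d) :
    ∃ c : ℝ, ∀ f : EuclideanSpace ℝ (Fin d) → ℝ, ∫ x, f (K.toUnit x) = c * ∫ x, f x := by
  refine ⟨|(LinearMap.det (K.scale : EuclideanSpace ℝ (Fin d) →ₗ[ℝ] _))⁻¹|, fun f => ?_⟩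
  have hmap : volume.map K.scale = _ := Measure.map_linearMap_addHaar_eq_smul_addHaar
    (volume : Measure (EuclideanSpace ℝ (Fin d))) K.scale.isUnit_det'.ne_zero
  calc ∫ x, f (K.toUnit x) = ∫ x, f (K.scale x) :=
        integral_add_right_eq_self (fun x => f (K.scale x)) _
    _ = ∫ x, f x ∂volume.map K.scale :=
        (K.scale.toContinuousLinearEquiv.toHomeomorph.measurableEmbedding.integral_map f).symm
    _ = _ := by
        rw [hmap, integral_smul_measure, ENNReal.toReal_ofReal (abs_nonneg _), smul_eq_mul]

theorem Rect.integral_comp_toUnit (K : Rect d) (f : EuclideanSpace ℝ (Fin d) → ℝ) :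
    ∫ x, f (K.toUnit x) = volume.real K.inner * ∫ x, f x := by
  obtain ⟨c, hc⟩ := K.exists_integral_comp_toUnit_eq_mul
  have hunit : volume.real (unitRect d).inner = 1 :=
    (unitRect d).volume_real_inner.trans (by simp [unitRect])
  have hpre : K.toUnit ⁻¹' (unitRect d).inner = K.inner :=
    ext fun x => K.toUnit_mem_inner_unitRect_iff
  have hvol : volume.real K.inner = c := by
    calc volume.real K.inner = ∫ x, (unitRect d).inner.indicator 1 (K.toUnit x) := by
          rw [← integral_indicator_one K.measurableSet_inner, ← hpre]
          rfl
      _ = c := by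
          rw [hc, integral_indicator_one (unitRect d).measurableSet_inner, hunit, mul_one]
  rw [hc, hvol]

theorem add_mul_pow_eq_sum_fin {R : Type*} [CommSemiring R] (a b t : R) {m p : ℕ} (hm : m ≤ p) :
    (a + b * t) ^ m =
      ∑ j : Fin (p + 1), b ^ (j : ℕ) * a ^ (m - j) * m.choose j * t ^ (j : ℕ) := by
  rw [Fin.sum_univ_eq_sum_range (fun j => b ^ j * a ^ (m - j) * m.choose j * t ^ j) (p + 1),
    add_comm, add_pow, ← Finset.sum_subset (Finset.range_mono (Nat.succ_le_succ hm))]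
  · exact Finset.sum_congr rfl fun j _ => by ring
  · intro j _ hj
    rw [Nat.choose_eq_zero_of_lt (by simpa using hj)]
    simp

theorem Rect.exists_eval_eq_sum_mono (K : Rect d) {p : ℕ} {q : MvPolynomial (Fin d) ℝ}
    (hq : q ∈ MvPolynomial.restrictDegree (Fin d) ℝ p) :
    ∃ a : (Fin d → Fin (p + 1)) → ℝ, ∀ x : EuclideanSpace ℝ (Fin d),
      MvPolynomial.eval (fun i => x i) q = ∑ I, a I * mono I (K.toUnit x) := by
  rw [MvPolynomial.mem_restrictDegree] at hq
  refine ⟨fun I => ∑ m ∈ q.support, q.coeff m * ∏ i, ((K.upper i - K.lower i) ^ (I i : ℕ) *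
    K.lower i ^ (m i - I i) * (m i).choose (I i)), fun x => ?_⟩
  have hx : ∀ i, x i = K.lower i + (K.upper i - K.lower i) * K.toUnit x i := fun i => by
    rw [K.toUnit_apply, mul_div_cancel₀ _ (K.side_pos i).ne', add_sub_cancel]
  rw [MvPolynomial.eval_eq']
  simp_rw [Finset.sum_mul]
  rw [Finset.sum_comm]
  refine Finset.sum_congr rfl fun m hm => ?_
  rw [Finset.prod_congr rfl fun i _ =>
      (congrArg (· ^ m i) (hx i)).trans (add_mul_pow_eq_sum_fin _ _ _ (hq m hm i)),
    Finset.prod_univ_sum, Fintype.piFinset_univ, Finset.mul_sum]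
  refine Finset.sum_congr rfl fun I _ => ?_
  rw [Finset.prod_mul_distrib, mono, mul_assoc]

end UnitCube

/-! ### Bubble functions with prescribed moments -/

section Bubble

variable {d p : ℕ}

/-- `f` is `L²(K)`-orthogonal to the polynomials of degree at most `p` in each variable. -/
def Rect.IsPolyOrthogonal (K : Rect d) (p : ℕ) (f : EuclideanSpace ℝ (Fin d) → ℝ) : Prop :=
  ∀ q ∈ MvPolynomial.restrictDegree (Fin d) ℝ p,
    ∫ x in K.inner, f x * MvPolynomial.eval (fun i => x i) q = 0

/-- The scaled moment of `f` on `K` with respect to the monomial with exponents `I`. -/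
noncomputable def Rect.moment (K : Rect d) (f : EuclideanSpace ℝ (Fin d) → ℝ)
    (I : Fin d → Fin (p + 1)) : ℝ :=
  (volume.real K.inner)⁻¹ * ∫ x in K.inner, f x * mono I (K.toUnit x)

theorem Rect.continuous_mono_toUnit (K : Rect d) (I : Fin d → Fin (p + 1)) :
    Continuous fun x => mono I (K.toUnit x) :=
  (continuous_mono I).comp K.toUnit.continuous

theorem Rect.ae_abs_mono_toUnit_le_one (K : Rect d) (I : Fin d → Fin (p + 1)) :
    ∀ᵐ x ∂volume.restrict K.inner, |mono I (K.toUnit x)| ≤ 1 :=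
  (ae_restrict_mem K.measurableSet_inner).mono fun _ hx =>
    abs_mono_le_one I (K.toUnit_mem_inner_unitRect_iff.2 hx)

theorem Rect.memLp_mul_mono_toUnit (K : Rect d) {f : EuclideanSpace ℝ (Fin d) → ℝ}
    (hf : MemLp f 2 (volume.restrict K.inner)) (I : Fin d → Fin (p + 1)) :
    MemLp (fun x => f x * mono I (K.toUnit x)) 2 (volume.restrict K.inner) := by
  refine hf.of_le (hf.aestronglyMeasurable.mul
    (K.continuous_mono_toUnit I).aestronglyMeasurable) ?_
  filter_upwards [K.ae_abs_mono_toUnit_le_one I] with x hx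
  rw [norm_mul]
  exact mul_le_of_le_one_right (norm_nonneg _) hx

theorem Rect.abs_moment_le (K : Rect d) {f : EuclideanSpace ℝ (Fin d) → ℝ}
    (hf : MemLp f 2 (volume.restrict K.inner)) (I : Fin d → Fin (p + 1)) :
    |K.moment f I| ≤ √((volume.real K.inner)⁻¹ * ∫ x in K.inner, f x ^ 2) := by
  have hK := K.volume_real_inner_pos
  have hfI := K.memLp_mul_mono_toUnit hf I
  have hle : ∫ x in K.inner, (f x * mono I (K.toUnit x)) ^ 2 ≤ ∫ x in K.inner, f x ^ 2 := by
    refine integral_mono_ae hfI.integrable_sq hf.integrable_sq ?_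
    filter_upwards [K.ae_abs_mono_toUnit_le_one I] with x hx
    rw [mul_pow]
    exact mul_le_of_le_one_right (sq_nonneg _) ((sq_le_one_iff_abs_le_one _).2 hx)
  refine Real.abs_le_sqrt ?_
  have hcs := sq_integral_le_mul_integral_sq hfI
  rw [measureReal_restrict_apply_univ] at hcs
  calc K.moment f I ^ 2
      = (volume.real K.inner)⁻¹ ^ 2 * (∫ x in K.inner, f x * mono I (K.toUnit x)) ^ 2 := mul_pow ..
    _ ≤ (volume.real K.inner)⁻¹ ^ 2 * (volume.real K.inner * ∫ x in K.inner, f x ^ 2) := by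
        gcongr
        exact hcs.trans (by gcongr)
    _ = (volume.real K.inner)⁻¹ * ∫ x in K.inner, f x ^ 2 := by field_simp

/-- The combination of the functions `b I`, transported from the unit cube to `K`, whose
coefficients are the moments of `f`. If the `b I` are dual to the monomials, it has the same moments
as `f`. -/
noncomputable def Rect.bubble (K : Rect d)
    (b : (Fin d → Fin (p + 1)) → EuclideanSpace ℝ (Fin d) → ℝ)
    (f : EuclideanSpace ℝ (Fin d) → ℝ) : EuclideanSpace ℝ (Fin d) → ℝ :=
  ∑ I, K.moment f I • (b I ∘ K.toUnit)

theorem Rect.comp_toUnit_mem_testFunctions (K : Rect d) {φ : EuclideanSpace ℝ (Fin d) → ℝ}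
    (hφ : φ ∈ testFunctions (unitRect d).inner) : φ ∘ K.toUnit ∈ testFunctions K.inner := by
  refine ⟨hφ.1.comp K.contDiff_toUnit, hφ.2.1.comp_homeomorph K.toUnit, ?_⟩
  rw [tsupport_comp_eq_preimage φ K.toUnit]
  exact fun x hx => K.toUnit_mem_inner_unitRect_iff.1 (hφ.2.2 hx)

variable {b : (Fin d → Fin (p + 1)) → EuclideanSpace ℝ (Fin d) → ℝ}

theorem Rect.bubble_mem_testFunctions (K : Rect d)
    (hb : ∀ I, b I ∈ testFunctions (unitRect d).inner) (f : EuclideanSpace ℝ (Fin d) → ℝ) :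
    K.bubble b f ∈ testFunctions K.inner :=
  Submodule.sum_mem _ fun I _ => Submodule.smul_mem _ _ (K.comp_toUnit_mem_testFunctions (hb I))

theorem Rect.integral_bubble_mul_mono (K : Rect d)
    (hb : ∀ I, b I ∈ testFunctions (unitRect d).inner)
    (hdual : ∀ I J, ∫ x, b J x * mono I x = if I = J then 1 else 0)
    (f : EuclideanSpace ℝ (Fin d) → ℝ) (I : Fin d → Fin (p + 1)) :
    ∫ x in K.inner, K.bubble b f x * mono I (K.toUnit x) =
      ∫ x in K.inner, f x * mono I (K.toUnit x) := by
  have hK := K.volume_real_inner_pos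
  have hint : ∀ J, Integrable fun x => b J (K.toUnit x) * mono I (K.toUnit x) := fun J =>
    integrable_testFunction_mul (K.comp_toUnit_mem_testFunctions (hb J))
      (K.continuous_mono_toUnit I)
  calc ∫ x in K.inner, K.bubble b f x * mono I (K.toUnit x)
      = ∫ x, K.bubble b f x * mono I (K.toUnit x) := by
        refine setIntegral_eq_integral_of_forall_compl_eq_zero fun x hx => ?_
        rw [image_eq_zero_of_notMem_tsupport fun h =>
          hx ((K.bubble_mem_testFunctions hb f).2.2 h), zero_mul]
    _ = ∫ x, ∑ J, K.moment f J * (b J (K.toUnit x) * mono I (K.toUnit x)) := by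
        simp only [Rect.bubble, Finset.sum_apply, Pi.smul_apply, Function.comp_apply, smul_eq_mul,
          Finset.sum_mul, mul_assoc]
    _ = ∑ J, K.moment f J * (volume.real K.inner * if I = J then 1 else 0) := by
        rw [integral_finsetSum _ fun J _ => (hint J).const_mul _]
        refine Finset.sum_congr rfl fun J _ => ?_
        rw [integral_const_mul, K.integral_comp_toUnit fun x => b J x * mono I x, hdual]
    _ = ∫ x in K.inner, f x * mono I (K.toUnit x) := by
        simp only [mul_ite, mul_one, mul_zero, Finset.sum_ite_eq, Finset.mem_univ, if_true,
          Rect.moment]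
        field_simp

theorem Rect.isPolyOrthogonal_of_integral_mul_mono_eq_zero (K : Rect d)
    {f : EuclideanSpace ℝ (Fin d) → ℝ} (hf : MemLp f 2 (volume.restrict K.inner))
    (h : ∀ I : Fin d → Fin (p + 1), ∫ x in K.inner, f x * mono I (K.toUnit x) = 0) :
    K.IsPolyOrthogonal p f := by
  intro q hq
  obtain ⟨a, ha⟩ := K.exists_eval_eq_sum_mono hq
  simp_rw [ha, Finset.mul_sum, mul_left_comm (f _)]
  rw [integral_finsetSum _ fun I _ =>
    ((K.memLp_mul_mono_toUnit hf I).integrable one_le_two).const_mul _]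
  simp [integral_const_mul, h]

theorem Rect.isPolyOrthogonal_sub_bubble (K : Rect d)
    (hb : ∀ I, b I ∈ testFunctions (unitRect d).inner)
    (hdual : ∀ I J, ∫ x, b J x * mono I x = if I = J then 1 else 0)
    {f : EuclideanSpace ℝ (Fin d) → ℝ} (hf : MemLp f 2 (volume.restrict K.inner)) :
    K.IsPolyOrthogonal p fun x => f x - K.bubble b f x := by
  have hB := K.bubble_mem_testFunctions hb f
  have hBL : MemLp (K.bubble b f) 2 (volume.restrict K.inner) :=
    (hB.1.continuous.memLp_of_hasCompactSupport hB.2.1).restrict _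
  refine K.isPolyOrthogonal_of_integral_mul_mono_eq_zero (hf.sub hBL) fun I => ?_
  simp only [sub_mul]
  rw [integral_sub ((K.memLp_mul_mono_toUnit hf I).integrable one_le_two)
    ((K.memLp_mul_mono_toUnit hBL I).integrable one_le_two),
    K.integral_bubble_mul_mono hb hdual, sub_self]

theorem Rect.norm_fderiv_bubble_le (K : Rect d) {h : ℝ} (hh : 0 < h)
    (hK : ∀ i, h ≤ K.upper i - K.lower i) (hb : ∀ I, Differentiable ℝ (b I))
    {M : (Fin d → Fin (p + 1)) → ℝ} (hM : ∀ I x, ‖fderiv ℝ (b I) x‖ ≤ M I)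
    {f : EuclideanSpace ℝ (Fin d) → ℝ} (hf : MemLp f 2 (volume.restrict K.inner))
    (x : EuclideanSpace ℝ (Fin d)) :
    ‖fderiv ℝ (K.bubble b f) x‖ ≤
      (∑ I, M I) * h⁻¹ * √((volume.real K.inner)⁻¹ * ∫ x in K.inner, f x ^ 2) := by
  have hbK : ∀ I, DifferentiableAt ℝ (b I ∘ K.toUnit) x := fun I =>
    ((hb I).comp (K.contDiff_toUnit.differentiable (by simp))) x
  rw [Rect.bubble, fderiv_sum fun I _ => (hbK I).const_smul _, mul_assoc, Finset.sum_mul]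
  refine (norm_sum_le _ _).trans (Finset.sum_le_sum fun I _ => ?_)
  rw [fderiv_const_smul (hbK I), norm_smul, mul_comm, ← mul_assoc]
  have hMI := K.norm_fderiv_comp_toUnit_le hh hK (hb I) (hM I) x
  exact mul_le_mul hMI (K.abs_moment_le hf I) (norm_nonneg _) ((norm_nonneg _).trans hMI)

theorem exists_bubble (d p : ℕ) : ∃ C : ℝ, ∀ (K : Rect d) (h : ℝ), 0 < h →
    (∀ i, h ≤ K.upper i - K.lower i) → ∀ f : EuclideanSpace ℝ (Fin d) → ℝ,
    MemLp f 2 (volume.restrict K.inner) → ∃ b ∈ testFunctions K.inner,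
      (K.IsPolyOrthogonal p fun x => f x - b x) ∧ (K.IsPolyOrthogonal p f → b = 0) ∧
      ∫ x in K.inner, ‖fderiv ℝ b x‖ ^ 2 ≤ (C * h⁻¹) ^ 2 * ∫ x in K.inner, f x ^ 2 := by
  classical
  obtain ⟨b, hb, hdual⟩ := exists_dual_testFunctions (μ := volume) (unitRect d).isOpen_inner
    (continuous_mono (p := p)) coeff_eq_zero_of_sum_mono_eq_zero
  choose M hM using fun I => ((hb I).2.1.fderiv (𝕜 := ℝ)).exists_bound_of_continuous
    ((hb I).1.continuous_fderiv (by simp))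
  refine ⟨∑ I, M I, fun K h hh hK f hf => ?_⟩
  by_cases hforth : K.IsPolyOrthogonal p f
  · refine ⟨0, zero_mem _, by simpa using hforth, fun _ => rfl, ?_⟩
    simpa using by positivity
  refine ⟨K.bubble b f, K.bubble_mem_testFunctions hb f,
    K.isPolyOrthogonal_sub_bubble hb hdual hf, fun h => absurd h hforth, ?_⟩
  have hV := K.volume_real_inner_pos
  have hbd := fun x => K.norm_fderiv_bubble_le hh hK
    (fun I => (hb I).1.differentiable (by simp)) hM hf x
  calc ∫ x in K.inner, ‖fderiv ℝ (K.bubble b f) x‖ ^ 2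
      ≤ ∫ x in K.inner, ((∑ I, M I) * h⁻¹ * √((volume.real K.inner)⁻¹ *
        ∫ x in K.inner, f x ^ 2)) ^ 2 :=
        integral_mono_of_nonneg (ae_of_all _ fun x => sq_nonneg _) (integrable_const _)
          (ae_of_all _ fun x => pow_le_pow_left₀ (norm_nonneg _) (hbd x) 2)
    _ = ((∑ I, M I) * h⁻¹) ^ 2 * ∫ x in K.inner, f x ^ 2 := by
        rw [integral_const, measureReal_restrict_apply_univ, smul_eq_mul, mul_pow _ (√_),
          Real.sq_sqrt (mul_nonneg (inv_nonneg.2 hV.le) (integral_nonneg fun x => sq_nonneg _))]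
        field_simp

end Bubble

/-! ### Meshes and layers of cells -/

section Layers

variable {d : ℕ} {Ω : Set (EuclideanSpace ℝ (Fin d))}

theorem RectMesh.closed_subset_closure (T : RectMesh Ω) {K : Rect d} (hK : K ∈ T.cells) :
    K.closed ⊆ closure Ω := by
  rw [T.closure_eq]
  exact subset_biUnion_of_mem (u := Rect.closed) hK

theorem RectMesh.biUnion_inner_ae_eq (T : RectMesh Ω) :
    (⋃ K ∈ T.cells, K.inner) =ᵐ[volume] Ω := by
  refine (LE.le.eventuallyLE (iUnion₂_subset T.inner_subset)).antisymm ?_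
  have hcover : Ω ⊆ ⋃ K ∈ T.cells, K.closed := T.closure_eq ▸ subset_closure
  have hae : (⋃ K ∈ T.cells, K.inner) =ᵐ[volume] ⋃ K ∈ T.cells, K.closed :=
    Filter.EventuallyEq.countable_bUnion T.cells.countable_toSet fun K _ => K.inner_ae_eq_closed
  exact (LE.le.eventuallyLE hcover).trans hae.symm.le

theorem RectMesh.integral_eq_sum (T : RectMesh Ω) {f : EuclideanSpace ℝ (Fin d) → ℝ}
    (hf : IntegrableOn f Ω) : ∫ x in Ω, f x = ∑ K ∈ T.cells, ∫ x in K.inner, f x := by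
  rw [← Measure.restrict_congr_set T.biUnion_inner_ae_eq]
  exact integral_biUnion_finset _ (fun K _ => K.measurableSet_inner)
    (fun K hK L hL hKL => T.inner_disjoint K hK L hL hKL)
    fun K hK => hf.mono_set (T.inner_subset K hK)

/-- The union of a finite set of closed cells. It is used to describe patches by their cells. -/
def cellUnion (S : Finset (Rect d)) : Set (EuclideanSpace ℝ (Fin d)) := ⋃ K ∈ S, K.closed

theorem mem_cellUnion {S : Finset (Rect d)} {x : EuclideanSpace ℝ (Fin d)} :
    x ∈ cellUnion S ↔ ∃ K ∈ S, x ∈ K.closed := by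
  simp [cellUnion]

theorem cellUnion_mono {S S' : Finset (Rect d)} (h : S ⊆ S') : cellUnion S ⊆ cellUnion S' :=
  biUnion_subset_biUnion_left h

theorem isClosed_cellUnion (S : Finset (Rect d)) : IsClosed (cellUnion S) :=
  S.finite_toSet.isClosed_biUnion fun K _ => K.isClosed_closed

open Classical in
/-- The cells that touch one of the cells in `S`: the patch operator `N` on sets of cells. -/
noncomputable def RectMesh.grow (T : RectMesh Ω) (S : Finset (Rect d)) : Finset (Rect d) :=
  T.cells.filter fun K => (cellUnion S ∩ K.closed).Nonempty

theorem RectMesh.mem_grow (T : RectMesh Ω) {S : Finset (Rect d)} {K : Rect d} :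
    K ∈ T.grow S ↔ K ∈ T.cells ∧ (cellUnion S ∩ K.closed).Nonempty := by
  simp [RectMesh.grow]

theorem RectMesh.mem_grow_of_inter_nonempty (T : RectMesh Ω) {S : Finset (Rect d)} {K L : Rect d}
    (hK : K ∈ S) (hL : L ∈ T.cells) (hKL : (K.closed ∩ L.closed).Nonempty) : L ∈ T.grow S :=
  T.mem_grow.2 ⟨hL, hKL.mono (inter_subset_inter_left _ fun _ hx => mem_cellUnion.2 ⟨K, hK, hx⟩)⟩

theorem RectMesh.grow_subset_cells (T : RectMesh Ω) (S : Finset (Rect d)) :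
    T.grow S ⊆ T.cells :=
  fun _ hK => (T.mem_grow.1 hK).1

theorem RectMesh.subset_grow (T : RectMesh Ω) {S : Finset (Rect d)} (hS : S ⊆ T.cells) :
    S ⊆ T.grow S := fun K hK =>
  T.mem_grow_of_inter_nonempty hK (hS hK) (by simpa using K.closed_nonempty)

theorem RectMesh.iterate_grow_subset_cells (T : RectMesh Ω) {S : Finset (Rect d)}
    (hS : S ⊆ T.cells) (n : ℕ) : T.grow^[n] S ⊆ T.cells := by
  cases n with
  | zero => exact hS
  | succ n => exact Function.iterate_succ_apply' T.grow n S ▸ T.grow_subset_cells _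

theorem RectMesh.monotone_iterate_grow (T : RectMesh Ω) {S : Finset (Rect d)}
    (hS : S ⊆ T.cells) : Monotone fun n => T.grow^[n] S :=
  monotone_nat_of_le_succ fun n =>
    Function.iterate_succ_apply' T.grow n S ▸ T.subset_grow (T.iterate_grow_subset_cells hS n)

theorem RectMesh.patch_closed_eq (T : RectMesh Ω) (G : Rect d) (k : ℕ) :
    T.patch k G.closed = cellUnion (T.grow^[k] {G}) := by
  induction k with
  | zero => simp [RectMesh.patch, cellUnion]
  | succ k ih =>
    rw [RectMesh.patch] at ih ⊢
    rw [Function.iterate_succ_apply', ih, Function.iterate_succ_apply']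
    ext x
    simp [RectMesh.nbhd, mem_cellUnion, T.mem_grow, (isClosed_cellUnion _).closure_eq, and_assoc]

theorem RectMesh.exists_mem_grow_of_isPreconnected (T : RectMesh Ω)
    {s : Set (EuclideanSpace ℝ (Fin d))} (hs : IsPreconnected s) (hsΩ : s ⊆ closure Ω)
    {S : Finset (Rect d)} (hne : (s ∩ cellUnion S).Nonempty) (hns : ¬ s ⊆ cellUnion S) :
    ∃ L ∈ T.grow S, L ∉ S ∧ (s ∩ L.closed).Nonempty := by
  classical
  have hcover : s ⊆ cellUnion S ∪ cellUnion (T.cells \ S) := fun z hz => by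
    obtain ⟨K, hK, hzK⟩ := mem_cellUnion.1 (T.closure_eq.subset (hsΩ hz))
    by_cases hKS : K ∈ S
    · exact Or.inl (mem_cellUnion.2 ⟨K, hKS, hzK⟩)
    · exact Or.inr (mem_cellUnion.2 ⟨K, Finset.mem_sdiff.2 ⟨hK, hKS⟩, hzK⟩)
  obtain ⟨x, hxs, hxS⟩ := not_subset.1 hns
  obtain ⟨z, hzs, hzS, hzL⟩ := isPreconnected_closed_iff.1 hs _ _ (isClosed_cellUnion _)
    (isClosed_cellUnion _) hcover hne ⟨x, hxs, (hcover hxs).resolve_left hxS⟩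
  obtain ⟨L, hL, hzL⟩ := mem_cellUnion.1 hzL
  rw [Finset.mem_sdiff] at hL
  exact ⟨L, T.mem_grow.2 ⟨hL.1, z, hzS, hzL⟩, hL.2, z, hzs, hzL⟩

section Labels

variable {τ : Type*}

open Classical in
/-- The labels of those cells in `S` that meet `s`, for a labelling `lab` of the cells. -/
noncomputable def labelsMeeting (lab : Rect d → τ) (s : Set (EuclideanSpace ℝ (Fin d)))
    (S : Finset (Rect d)) : Finset τ :=
  {K ∈ S | (s ∩ K.closed).Nonempty}.image lab

theorem mem_labelsMeeting {lab : Rect d → τ} {s : Set (EuclideanSpace ℝ (Fin d))}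
    {S : Finset (Rect d)} {t : τ} :
    t ∈ labelsMeeting lab s S ↔ ∃ K ∈ S, (s ∩ K.closed).Nonempty ∧ lab K = t := by
  simp [labelsMeeting, and_assoc]

theorem labelsMeeting_mono (lab : Rect d → τ) (s : Set (EuclideanSpace ℝ (Fin d)))
    {S S' : Finset (Rect d)} (h : S ⊆ S') : labelsMeeting lab s S ⊆ labelsMeeting lab s S' := by
  unfold labelsMeeting
  gcongr

/-- A cell of the second layer that is not in the first one does not touch `S`, so its label is
new. -/
theorem RectMesh.card_labelsMeeting_lt (T : RectMesh Ω) {s : Set (EuclideanSpace ℝ (Fin d))}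
    (hs : IsPreconnected s) (hsΩ : s ⊆ closure Ω) {lab : Rect d → τ}
    (hlab : ∀ K ∈ T.cells, ∀ L ∈ T.cells, (s ∩ K.closed).Nonempty → (s ∩ L.closed).Nonempty →
      lab K = lab L → (K.closed ∩ L.closed).Nonempty)
    {S : Finset (Rect d)} (hS : S ⊆ T.cells) (hne : (s ∩ cellUnion S).Nonempty)
    (hns : ¬ s ⊆ cellUnion (T.grow S)) :
    (labelsMeeting lab s S).card < (labelsMeeting lab s (T.grow (T.grow S))).card := by
  obtain ⟨L, hL, hLS, hLs⟩ := T.exists_mem_grow_of_isPreconnected hs hsΩ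
    (hne.mono (inter_subset_inter_right _ (cellUnion_mono (T.subset_grow hS)))) hns
  have hLT := T.grow_subset_cells _ hL
  refine Finset.card_lt_card ((Finset.ssubset_iff_of_subset (labelsMeeting_mono lab s
    ((T.subset_grow hS).trans (T.subset_grow (T.grow_subset_cells S))))).2
      ⟨lab L, mem_labelsMeeting.2 ⟨L, hL, hLs, rfl⟩, fun hmem => ?_⟩)
  obtain ⟨K, hK, hKs, hKL⟩ := mem_labelsMeeting.1 hmem
  exact hLS (T.mem_grow_of_inter_nonempty hK hLT (hlab K (hS hK) L hLT hKs hLs hKL))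

theorem RectMesh.subset_iterate_grow_of_labels [Fintype τ] (T : RectMesh Ω)
    {s : Set (EuclideanSpace ℝ (Fin d))} (hs : IsPreconnected s) (hsΩ : s ⊆ closure Ω)
    {lab : Rect d → τ}
    (hlab : ∀ K ∈ T.cells, ∀ L ∈ T.cells, (s ∩ K.closed).Nonempty → (s ∩ L.closed).Nonempty →
      lab K = lab L → (K.closed ∩ L.closed).Nonempty)
    {S : Finset (Rect d)} (hS : S ⊆ T.cells) (hne : (s ∩ cellUnion S).Nonempty) :
    s ⊆ cellUnion (T.grow^[2 * Fintype.card τ] S) := by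
  have hmono := T.monotone_iterate_grow hS
  have hdich : ∀ j, s ⊆ cellUnion (T.grow^[2 * j] S) ∨
      j < (labelsMeeting lab s (T.grow^[2 * j] S)).card := by
    intro j
    induction j with
    | zero =>
      obtain ⟨x, hxs, hxS⟩ := hne
      obtain ⟨K, hK, hxK⟩ := mem_cellUnion.1 hxS
      exact Or.inr (Finset.card_pos.2 ⟨lab K, mem_labelsMeeting.2 ⟨K, hK, ⟨x, hxs, hxK⟩, rfl⟩⟩)
    | succ j ih =>
      have hsucc : T.grow^[2 * (j + 1)] S = T.grow (T.grow (T.grow^[2 * j] S)) := by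
        rw [mul_add_one, Function.iterate_succ_apply', Function.iterate_succ_apply']
      by_cases hcov : s ⊆ cellUnion (T.grow (T.grow^[2 * j] S))
      · rw [hsucc]
        exact Or.inl (hcov.trans (cellUnion_mono (T.subset_grow (T.grow_subset_cells _))))
      · have hns : ¬ s ⊆ cellUnion (T.grow^[2 * j] S) := fun h => hcov (h.trans
          (cellUnion_mono (T.subset_grow (T.iterate_grow_subset_cells hS _))))
        rw [hsucc]
        exact Or.inr (lt_of_le_of_lt (ih.resolve_left hns) (T.card_labelsMeeting_lt hs hsΩ hlab
          (T.iterate_grow_subset_cells hS _) (hne.mono (inter_subset_inter_right _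
            (cellUnion_mono (hmono (Nat.zero_le _))))) hcov))
  exact (hdich _).resolve_right (Finset.card_le_univ _).not_gt

end Labels

/-- The directions in which `K` reaches the upper end `b` of a box. -/
noncomputable def Rect.cornerType (b : Fin d → ℝ) (K : Rect d) : Finset (Fin d) :=
  {i | b i ≤ K.upper i}

theorem Rect.corner_mem_closed {K : Rect d} {h : ℝ} (hK : ∀ i, h ≤ K.upper i - K.lower i)
    {a b : Fin d → ℝ} (hab : ∀ i, b i - a i < h) {x : EuclideanSpace ℝ (Fin d)}
    (hx : ∀ i, x i ∈ Icc (a i) (b i)) (hxK : x ∈ K.closed) :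
    WithLp.toLp 2 (fun i => if i ∈ K.cornerType b then b i else a i) ∈ K.closed := by
  intro i
  have hxi := hx i
  have hxKi := hxK i
  have hKi := hK i
  have habi := hab i
  simp only [Rect.cornerType, Finset.mem_filter, Finset.mem_univ, true_and, mem_Icc] at *
  split_ifs with hi
  · exact ⟨by linarith, hi⟩
  · exact ⟨by linarith, by linarith⟩

theorem Rect.inter_closed_nonempty_of_cornerType_eq {K L : Rect d} {h : ℝ}
    (hK : ∀ i, h ≤ K.upper i - K.lower i) (hL : ∀ i, h ≤ L.upper i - L.lower i)
    {a b : Fin d → ℝ} (hab : ∀ i, b i - a i < h) {s : Set (EuclideanSpace ℝ (Fin d))}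
    (hs : ∀ x ∈ s, ∀ i, x i ∈ Icc (a i) (b i)) (hKs : (s ∩ K.closed).Nonempty)
    (hLs : (s ∩ L.closed).Nonempty) (hKL : K.cornerType b = L.cornerType b) :
    (K.closed ∩ L.closed).Nonempty := by
  obtain ⟨x, hxs, hxK⟩ := hKs
  obtain ⟨y, hys, hyL⟩ := hLs
  exact ⟨_, Rect.corner_mem_closed hK hab (hs x hxs) hxK,
    hKL ▸ Rect.corner_mem_closed hL hab (hs y hys) hyL⟩

theorem Icc_inter_Icc_inter_uIcc_nonempty {α : Type*} [LinearOrder α] {a b a' b' x y : α}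
    (h : (Icc a b ∩ Icc a' b').Nonempty) (hx : x ∈ Icc a b) (hy : y ∈ Icc a' b') :
    (Icc a b ∩ Icc a' b' ∩ uIcc x y).Nonempty := by
  obtain ⟨w, hw, hw'⟩ := h
  refine ⟨max (max a a') (min x y), ⟨⟨by simp, ?_⟩, ⟨by simp, ?_⟩⟩, ⟨by simp, ?_⟩⟩
  · simp [hx.1.trans hx.2, hw'.1.trans hw.2, hx.2]
  · simp [hw.1.trans hw'.2, hy.1.trans hy.2, hy.2]
  · exact max_le (max_le (le_sup_of_le_left hx.1) (le_sup_of_le_right hy.1)) inf_le_sup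

theorem Rect.exists_mem_inter_mem_uIcc {K L : Rect d} (hKL : (K.closed ∩ L.closed).Nonempty)
    {x y : EuclideanSpace ℝ (Fin d)} (hx : x ∈ K.closed) (hy : y ∈ L.closed) :
    ∃ z ∈ K.closed ∩ L.closed, ∀ i, z i ∈ uIcc (x i) (y i) := by
  obtain ⟨w, hwK, hwL⟩ := hKL
  choose t ht htxy using fun i =>
    Icc_inter_Icc_inter_uIcc_nonempty ⟨w i, hwK i, hwL i⟩ (hx i) (hy i)
  exact ⟨WithLp.toLp 2 t, ⟨fun i => (ht i).1, fun i => (ht i).2⟩, htxy⟩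

theorem RectMesh.exists_pos_forall_dist_lt_inter_nonempty (T : RectMesh Ω) :
    ∃ δ > 0, ∀ K ∈ T.cells, ∀ L ∈ T.cells, ∀ x ∈ K.closed, ∀ y ∈ L.closed,
      dist x y < δ → (K.closed ∩ L.closed).Nonempty := by
  have h : ∀ᶠ δ in nhdsWithin (0 : ℝ) (Ioi 0), ∀ K ∈ T.cells, ∀ L ∈ T.cells, ∀ x ∈ K.closed,
      ∀ y ∈ L.closed, dist x y < δ → (K.closed ∩ L.closed).Nonempty := by
    simp only [Filter.eventually_all_finset]
    intro K _ L _
    by_cases hKL : (K.closed ∩ L.closed).Nonempty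
    · exact Filter.Eventually.of_forall fun _ _ _ _ _ _ => hKL
    · obtain ⟨r, hr, hr'⟩ := Metric.exists_pos_forall_lt_edist K.isCompact_closed L.isClosed_closed
        (disjoint_iff_inter_eq_empty.2 (not_nonempty_iff_eq_empty.1 hKL))
      filter_upwards [Ioo_mem_nhdsGT (show (0 : ℝ) < r from hr)] with δ hδ x hx y hy hxy
      have hrxy := hr' x hx y hy
      rw [edist_nndist, ENNReal.coe_lt_coe, ← NNReal.coe_lt_coe, coe_nndist] at hrxy
      linarith [hδ.2]
  obtain ⟨δ, hδ, hδ0⟩ := (h.and self_mem_nhdsWithin).exists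
  exact ⟨δ, hδ0, hδ⟩

theorem RectMesh.exists_pos_forall_dist_lt_exists_isPreconnected (T : RectMesh Ω) :
    ∃ δ > 0, ∀ x ∈ closure Ω, ∀ y ∈ closure Ω, dist x y < δ → ∃ s ⊆ closure Ω,
      IsPreconnected s ∧ x ∈ s ∧ y ∈ s ∧ ∀ z ∈ s, ∀ i, z i ∈ uIcc (x i) (y i) := by
  obtain ⟨δ, hδ0, hδ⟩ := T.exists_pos_forall_dist_lt_inter_nonempty
  refine ⟨δ, hδ0, fun x hx y hy hxy => ?_⟩
  obtain ⟨K, hK, hxK⟩ := mem_cellUnion.1 (T.closure_eq.subset hx)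
  obtain ⟨L, hL, hyL⟩ := mem_cellUnion.1 (T.closure_eq.subset hy)
  obtain ⟨z, hz, hzxy⟩ := Rect.exists_mem_inter_mem_uIcc (hδ K hK L hL x hxK y hyL hxy) hxK hyL
  have hbox : Convex ℝ {w : EuclideanSpace ℝ (Fin d) | ∀ i, w i ∈ uIcc (x i) (y i)} :=
    fun u hu v hv a b ha hb hab i => convex_uIcc _ _ (hu i) (hv i) ha hb hab
  refine ⟨segment ℝ x z ∪ segment ℝ z y, union_subset
      ((K.convex_closed.segment_subset hxK hz.1).trans (T.closed_subset_closure hK))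
      ((L.convex_closed.segment_subset hz.2 hyL).trans (T.closed_subset_closure hL)),
    IsPreconnected.union z (right_mem_segment _ _ _) (left_mem_segment _ _ _)
      (convex_segment _ _).isPreconnected (convex_segment _ _).isPreconnected,
    Or.inl (left_mem_segment _ _ _), Or.inr (right_mem_segment _ _ _), union_subset
      (hbox.segment_subset (fun i => left_mem_uIcc) hzxy)
      (hbox.segment_subset hzxy fun i => right_mem_uIcc)⟩

/-- The reference mesh `T₀` makes `δ` independent of `T`: it shows that nearby points of `closure Ω`
are joined inside `closure Ω` within their bounding box. -/
theorem RectMesh.exists_pos_forall_dist_lt_mem_iterate_grow (T₀ : RectMesh Ω) :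
    ∃ δ > 0, ∀ (T : RectMesh Ω) (h : ℝ), (∀ K ∈ T.cells, ∀ i, h ≤ K.upper i - K.lower i) →
      ∀ S ⊆ T.cells, ∀ x ∈ cellUnion S, ∀ y ∈ closure Ω, dist x y < δ → dist x y < h →
        y ∈ cellUnion (T.grow^[2 * 2 ^ d] S) := by
  obtain ⟨δ, hδ0, hδ⟩ := T₀.exists_pos_forall_dist_lt_exists_isPreconnected
  refine ⟨δ, hδ0, fun T h hT S hS x hx y hy hxyδ hxyh => ?_⟩
  obtain ⟨K, hK, hxK⟩ := mem_cellUnion.1 hx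
  obtain ⟨s, hsΩ, hs, hxs, hys, hsxy⟩ :=
    hδ x (T.closed_subset_closure (hS hK) hxK) y hy hxyδ
  have hside : ∀ i, max (x i) (y i) - min (x i) (y i) < h := fun i => by
    rw [max_sub_min_eq_abs]
    refine lt_of_le_of_lt ?_ hxyh
    rw [dist_comm, dist_eq_norm]
    exact PiLp.norm_apply_le (y - x) i
  have hcover := T.subset_iterate_grow_of_labels hs hsΩ (lab := Rect.cornerType _)
    (fun K hK L hL => Rect.inter_closed_nonempty_of_cornerType_eq (hT K hK) (hT L hL) hside hsxy)
    hS ⟨x, hxs, hx⟩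
  rw [Fintype.card_finset, Fintype.card_fin] at hcover
  exact hcover hys

end Layers

/-! ### Functions in `H¹₀(Ω)` -/

section SetIntegrals

variable {X : Type*} [MeasurableSpace X] {μ : Measure X}

theorem integral_norm_sq_eq_norm_sq {F : Type*} [NormedAddCommGroup F] [InnerProductSpace ℝ F]
    (f : Lp F 2 μ) : ∫ x, ‖f x‖ ^ 2 ∂μ = ‖f‖ ^ 2 := by
  rw [← real_inner_self_eq_norm_sq, L2.inner_def]
  simp_rw [real_inner_self_eq_norm_sq]

theorem integrable_norm_sq {F : Type*} [NormedAddCommGroup F] (f : Lp F 2 μ) :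
    Integrable (fun x => ‖f x‖ ^ 2) μ :=
  (Lp.memLp f).integrable_norm_pow two_ne_zero

theorem continuous_setIntegral_norm_sq {F : Type*} [NormedAddCommGroup F] [InnerProductSpace ℝ F]
    (s : Set X) : Continuous fun f : Lp F 2 μ => ∫ x in s, ‖f x‖ ^ 2 ∂μ := by
  have hnorm : ∀ f : Lp F 2 μ,
      ∫ x in s, ‖f x‖ ^ 2 ∂μ = ‖LpToLpRestrictCLM X F ℝ μ 2 s f‖ ^ 2 := fun f => by
    rw [← integral_norm_sq_eq_norm_sq]
    refine integral_congr_ae ?_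
    filter_upwards [LpToLpRestrictCLM_coeFn ℝ s f] with x hx
    rw [hx]
  simp_rw [hnorm]
  fun_prop

theorem continuous_setIntegral_L2 {s : Set X} (hs : MeasurableSet s) (hμs : μ s ≠ ⊤) :
    Continuous fun f : Lp ℝ 2 μ => ∫ x in s, f x ∂μ := by
  simp_rw [← L2.inner_indicatorConstLp_one hs hμs]
  fun_prop

end SetIntegrals

section Gradient

variable {E : Type*} [NormedAddCommGroup E] [InnerProductSpace ℝ E] [CompleteSpace E]

theorem norm_gradient (φ : E → ℝ) (x : E) : ‖∇ φ x‖ = ‖fderiv ℝ φ x‖ :=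
  LinearIsometryEquiv.norm_map _ _

theorem continuous_gradient {φ : E → ℝ} (hφ : ContDiff ℝ ∞ φ) : Continuous (∇ φ) :=
  (LinearIsometryEquiv.continuous _).comp (hφ.continuous_fderiv (by simp))

theorem gradient_mul {η φ : E → ℝ} {x : E} (hη : DifferentiableAt ℝ η x)
    (hφ : DifferentiableAt ℝ φ x) :
    ∇ (fun y => η y * φ y) x = η x • ∇ φ x + φ x • ∇ η x := by
  simp only [gradient]
  rw [fderiv_fun_mul hη hφ]
  simp

theorem gradient_eq_of_eqOn {η φ : E → ℝ} {U : Set E} (hU : IsOpen U) (h : EqOn η φ U) {x : E}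
    (hx : x ∈ U) : ∇ η x = ∇ φ x :=
  (h.eventuallyEq_of_mem (hU.mem_nhds hx)).gradient_eq

end Gradient

section H10

variable {d : ℕ} {Ω : Set (EuclideanSpace ℝ (Fin d))}

theorem poincare_H10 {z : L2Pair Ω} (hz : z ∈ H10 Ω) {s : Set (EuclideanSpace ℝ (Fin d))}
    (hsΩ : s ⊆ Ω) (hsm : MeasurableSet s) (hsc : Convex ℝ s) (hsb : Bornology.IsBounded s) :
    volume.real s * (∫ x in s, z.fst x ^ 2) - (∫ x in s, z.fst x) ^ 2 ≤
      2 ^ d * Metric.diam s ^ 2 * volume.real s * ∫ x in s, ‖z.snd x‖ ^ 2 := by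
  have hμ : (volume.restrict Ω).restrict s = volume.restrict s :=
    Measure.restrict_restrict_of_subset hsΩ
  have hμs : volume.restrict Ω s ≠ ⊤ :=
    ((Measure.restrict_apply_le _ _).trans_lt hsb.measure_lt_top).ne
  refine closure_minimal (s := (testPairs Ω : Set (L2Pair Ω))) (t := {z |
    volume.real s * (∫ x in s, z.fst x ^ 2) - (∫ x in s, z.fst x) ^ 2 ≤
      2 ^ d * Metric.diam s ^ 2 * volume.real s * ∫ x in s, ‖z.snd x‖ ^ 2}) ?_ ?_ hz
  · rintro y ⟨φ, hφ, -, -, hy, hy'⟩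
    have hys : y.fst =ᵐ[volume.restrict s] φ := ae_mono (Measure.restrict_mono_set _ hsΩ) hy
    have hys' : y.snd =ᵐ[volume.restrict s] ∇ φ := ae_mono (Measure.restrict_mono_set _ hsΩ) hy'
    have hsq : ∫ x in s, y.fst x ^ 2 = ∫ x in s, φ x ^ 2 :=
      integral_congr_ae (hys.fun_comp (· ^ 2))
    have hgrad : ∫ x in s, ‖y.snd x‖ ^ 2 = ∫ x in s, ‖fderiv ℝ φ x‖ ^ 2 := by
      simp_rw [← norm_gradient]
      exact integral_congr_ae (hys'.fun_comp (‖·‖ ^ 2))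
    rw [mem_ofPred_eq, hsq, hgrad, integral_congr_ae hys]
    simpa using poincare_of_contDiff (hφ.of_le (by simp)) hsm hsc hsb
  · have hfst : Continuous fun z : L2Pair Ω => ∫ x in s, ‖z.fst x‖ ^ 2 :=
      hμ ▸ (continuous_setIntegral_norm_sq s).comp (by fun_prop)
    have hsnd : Continuous fun z : L2Pair Ω => ∫ x in s, ‖z.snd x‖ ^ 2 :=
      hμ ▸ (continuous_setIntegral_norm_sq s).comp (by fun_prop)
    have hint : Continuous fun z : L2Pair Ω => ∫ x in s, z.fst x :=
      hμ ▸ (continuous_setIntegral_L2 hsm hμs).comp (by fun_prop)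
    simp only [Real.norm_eq_abs, sq_abs] at hfst
    exact isClosed_le (by fun_prop) (by fun_prop)

theorem exists_smul_mem_H10 {η : EuclideanSpace ℝ (Fin d) → ℝ} (hη : ContDiff ℝ ∞ η) {a M : ℝ}
    (hηa : ∀ x, |η x| ≤ a) (hηM : ∀ x, ‖fderiv ℝ η x‖ ≤ M) {z : L2Pair Ω} (hz : z ∈ H10 Ω) :
    ∃ w ∈ H10 Ω, (w.fst =ᵐ[volume.restrict Ω] fun x => η x * z.fst x) ∧
      w.snd =ᵐ[volume.restrict Ω] fun x => η x • z.snd x + z.fst x • ∇ η x := by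
  have hmem : MemLp η ⊤ (volume.restrict Ω) :=
    memLp_top_of_bound hη.continuous.aestronglyMeasurable a (Filter.Eventually.of_forall hηa)
  have hmem' : MemLp (∇ η) ⊤ (volume.restrict Ω) :=
    memLp_top_of_bound (continuous_gradient hη).aestronglyMeasurable M
      (Filter.Eventually.of_forall fun x => (norm_gradient η x).trans_le (hηM x))
  obtain ⟨M₁, hM₁⟩ := exists_clm_coeFn_eq_bilin (ContinuousLinearMap.mul ℝ ℝ) hmem
  obtain ⟨M₂, hM₂⟩ := exists_clm_coeFn_eq_bilin
    (ContinuousLinearMap.lsmul ℝ ℝ : ℝ →L[ℝ] EuclideanSpace ℝ (Fin d) →L[ℝ] _) hmem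
  obtain ⟨M₃, hM₃⟩ := exists_clm_coeFn_eq_bilin
    (ContinuousLinearMap.lsmul ℝ ℝ : ℝ →L[ℝ] EuclideanSpace ℝ (Fin d) →L[ℝ] _).flip hmem'
  let m : L2Pair Ω → L2Pair Ω := fun z => WithLp.toLp 2 (M₁ z.fst, M₂ z.snd + M₃ z.fst)
  have hm : Continuous m := by fun_prop
  have hm_snd : ∀ z, (m z).snd =ᵐ[volume.restrict Ω] fun x => η x • z.snd x + z.fst x • ∇ η x :=
    fun z => (Lp.coeFn_add _ _).trans ((hM₂ z.snd).add (hM₃ z.fst))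
  refine ⟨m z, map_mem_closure hm hz ?_, hM₁ z.fst, hm_snd z⟩
  rintro y ⟨φ, hφ, hφc, hφΩ, hy, hy'⟩
  refine ⟨fun x => η x * φ x, hη.mul hφ, hφc.mul_left,
    (closure_mono (Function.support_mul_subset_right η φ)).trans hφΩ, ?_, ?_⟩
  · filter_upwards [hM₁ y.fst, hy] with x hx hxφ
    exact hx.trans (congrArg (η x * ·) hxφ)
  · filter_upwards [hm_snd y, hy, hy'] with x hx hxφ hxφ'
    rw [hx, hxφ, hxφ', gradient_mul (hη.differentiable (by simp) x)
      (hφ.differentiable (by simp) x)]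

theorem exists_mem_H10_of_testFunction {φ : EuclideanSpace ℝ (Fin d) → ℝ}
    (hφ : φ ∈ testFunctions Ω) :
    ∃ z ∈ H10 Ω, z.fst =ᵐ[volume.restrict Ω] φ ∧ z.snd =ᵐ[volume.restrict Ω] ∇ φ := by
  obtain ⟨hφ, hφc, hφΩ⟩ := hφ
  have hgc : HasCompactSupport (∇ φ) := (hφc.fderiv (𝕜 := ℝ)).comp_left (map_zero _)
  have hmem : MemLp φ 2 (volume.restrict Ω) :=
    (hφ.continuous.memLp_of_hasCompactSupport hφc).restrict _
  have hmem' : MemLp (∇ φ) 2 (volume.restrict Ω) :=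
    ((continuous_gradient hφ).memLp_of_hasCompactSupport hgc).restrict _
  exact ⟨WithLp.toLp 2 (hmem.toLp φ, hmem'.toLp (∇ φ)), Submodule.le_topologicalClosure _
    ⟨φ, hφ, hφc, hφΩ, hmem.coeFn_toLp, hmem'.coeFn_toLp⟩, hmem.coeFn_toLp, hmem'.coeFn_toLp⟩

end H10

/-! ### The space `W`, cell by cell -/

section KernelSpace

variable {d p : ℕ} {Ω : Set (EuclideanSpace ℝ (Fin d))}

theorem RectMesh.restrict_inner_le (T : RectMesh Ω) {K : Rect d} (hK : K ∈ T.cells) :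
    volume.restrict K.inner ≤ volume.restrict Ω :=
  Measure.restrict_mono_set _ (T.inner_subset K hK)

theorem RectMesh.restrict_restrict_inner (T : RectMesh Ω) {K : Rect d} (hK : K ∈ T.cells) :
    (volume.restrict Ω).restrict K.inner = volume.restrict K.inner :=
  Measure.restrict_restrict_of_subset (T.inner_subset K hK)

theorem RectMesh.restrict_restrict_closed (T : RectMesh Ω) {K : Rect d} (hK : K ∈ T.cells) :
    (volume.restrict Ω).restrict K.closed = volume.restrict K.inner := by
  rw [← T.restrict_restrict_inner hK]
  exact Measure.restrict_congr_set (ae_restrict_of_ae K.inner_ae_eq_closed.symm)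

theorem Rect.memLp_indicator_eval (K : Rect d) (q : MvPolynomial (Fin d) ℝ)
    (μ : Measure (EuclideanSpace ℝ (Fin d))) [IsFiniteMeasureOnCompacts μ] :
    MemLp (K.inner.indicator fun x => MvPolynomial.eval (fun i => x i) q) 2 μ := by
  have hq : Continuous fun x : EuclideanSpace ℝ (Fin d) => MvPolynomial.eval (fun i => x i) q :=
    (MvPolynomial.continuous_eval q).comp (by fun_prop)
  obtain ⟨C, hC⟩ := K.isCompact_closed.exists_bound_of_continuousOn hq.continuousOn
  have hfin : IsFiniteMeasure (μ.restrict K.inner) :=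
    isFiniteMeasure_restrict.2 K.isBounded_inner.measure_lt_top.ne
  rw [memLp_indicator_iff_restrict K.measurableSet_inner]
  exact MemLp.of_bound hq.aestronglyMeasurable C <| (ae_restrict_mem K.measurableSet_inner).mono
    fun x hx => hC x (K.inner_subset_closed hx)

theorem RectMesh.toLp_indicator_eval_mem_polySpace (T : RectMesh Ω) {K : Rect d}
    (hK : K ∈ T.cells) {q : MvPolynomial (Fin d) ℝ}
    (hq : q ∈ MvPolynomial.restrictDegree (Fin d) ℝ p) :
    (K.memLp_indicator_eval q (volume.restrict Ω)).toLp ∈ T.polySpace p := by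
  intro L hL
  rw [T.restrict_restrict_closed hL]
  have hcoe := ae_mono (T.restrict_inner_le hL)
    (K.memLp_indicator_eval q (volume.restrict Ω)).coeFn_toLp
  obtain rfl | hKL := eq_or_ne K L
  · refine ⟨q, hq, ?_⟩
    filter_upwards [hcoe, ae_restrict_mem K.measurableSet_inner] with x hx hxK
    rw [hx, indicator_of_mem hxK]
  · refine ⟨0, zero_mem _, ?_⟩
    filter_upwards [hcoe, ae_restrict_mem L.measurableSet_inner] with x hx hxL
    rw [hx, indicator_of_notMem (disjoint_right.1 (T.inner_disjoint K hK L hL hKL) hxL), map_zero]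

theorem RectMesh.mem_orthogonal_polySpace_iff (T : RectMesh Ω) {f : L2 Ω} :
    f ∈ (T.polySpace p)ᗮ ↔ ∀ K ∈ T.cells, K.IsPolyOrthogonal p f := by
  refine ⟨fun h K hK q hq => ?_, fun h v hv => ?_⟩
  · have hm := K.memLp_indicator_eval q (volume.restrict Ω)
    rw [← h _ (T.toLp_indicator_eval_mem_polySpace hK hq), L2.inner_def,
      ← T.restrict_restrict_inner hK, ← integral_indicator K.measurableSet_inner]
    refine integral_congr_ae ?_
    filter_upwards [hm.coeFn_toLp] with x hx
    by_cases hxK : x ∈ K.inner <;> simp [hx, hxK]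
  · rw [L2.inner_def, T.integral_eq_sum (L2.integrable_inner _ _)]
    refine Finset.sum_eq_zero fun K hK => ?_
    obtain ⟨q, hq, hvq⟩ := hv K hK
    rw [T.restrict_restrict_closed hK] at hvq
    rw [← h K hK q hq]
    exact integral_congr_ae (hvq.mono fun x hx => congrArg (f x * ·) hx)

theorem RectMesh.mem_kernelSpace_iff (T : RectMesh Ω) {w : L2Pair Ω} :
    w ∈ T.kernelSpace p ↔ w ∈ H10 Ω ∧ ∀ K ∈ T.cells, K.IsPolyOrthogonal p w.fst := by
  rw [← T.mem_orthogonal_polySpace_iff, ← Submodule.starProjection_apply_eq_zero_iff]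
  rfl

/-- The Poincaré inequality applies because the mean of `w` over each cell vanishes. -/
theorem RectMesh.poincare_kernelSpace (T : RectMesh Ω) {w : L2Pair Ω} (hw : w ∈ T.kernelSpace p)
    {K : Rect d} (hK : K ∈ T.cells) :
    ∫ x in K.inner, w.fst x ^ 2 ≤
      2 ^ d * Metric.diam K.closed ^ 2 * ∫ x in K.inner, ‖w.snd x‖ ^ 2 := by
  rw [T.mem_kernelSpace_iff] at hw
  have hone : (1 : MvPolynomial (Fin d) ℝ) ∈ MvPolynomial.restrictDegree (Fin d) ℝ p := by
    simp [MvPolynomial.mem_restrictDegree]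
  have hmean : ∫ x in K.inner, w.fst x = 0 := by simpa using hw.2 K hK 1 hone
  have hpoincare := poincare_H10 hw.1 (T.inner_subset K hK) K.measurableSet_inner K.convex_inner
    K.isBounded_inner
  rw [hmean, zero_pow two_ne_zero, sub_zero] at hpoincare
  refine le_of_mul_le_mul_left ?_ K.volume_real_inner_pos
  calc volume.real K.inner * ∫ x in K.inner, w.fst x ^ 2
      ≤ 2 ^ d * Metric.diam K.inner ^ 2 * volume.real K.inner *
          ∫ x in K.inner, ‖w.snd x‖ ^ 2 := hpoincare
    _ ≤ 2 ^ d * Metric.diam K.closed ^ 2 * volume.real K.inner *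
          ∫ x in K.inner, ‖w.snd x‖ ^ 2 := by
        gcongr
        exact K.diam_inner_le
    _ = volume.real K.inner *
          (2 ^ d * Metric.diam K.closed ^ 2 * ∫ x in K.inner, ‖w.snd x‖ ^ 2) := by ring

theorem RectMesh.exists_mem_H10_of_testFunctions (T : RectMesh Ω)
    {b : Rect d → EuclideanSpace ℝ (Fin d) → ℝ} (hb : ∀ K ∈ T.cells, b K ∈ testFunctions K.inner) :
    ∃ z ∈ H10 Ω, ∀ L ∈ T.cells, z.fst =ᵐ[volume.restrict L.inner] b L ∧
      z.snd =ᵐ[volume.restrict L.inner] ∇ (b L) := by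
  have hmem : ∑ K ∈ T.cells, b K ∈ testFunctions Ω := Submodule.sum_mem _ fun K hK =>
    ⟨(hb K hK).1, (hb K hK).2.1, (hb K hK).2.2.trans (T.inner_subset K hK)⟩
  obtain ⟨z, hz, hfst, hsnd⟩ := exists_mem_H10_of_testFunction hmem
  refine ⟨z, hz, fun L hL => ?_⟩
  have hsum : EqOn (∑ K ∈ T.cells, b K) (b L) L.inner := fun x hx => by
    rw [Finset.sum_apply]
    refine Finset.sum_eq_single_of_mem L hL fun K hK hKL => image_eq_zero_of_notMem_tsupport ?_
    exact fun hxK => disjoint_left.1 (T.inner_disjoint K hK L hL hKL) ((hb K hK).2.2 hxK) hx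
  constructor
  · filter_upwards [ae_mono (T.restrict_inner_le hL) hfst,
      ae_restrict_mem L.measurableSet_inner] with x hx hxL
    exact hx.trans (hsum hxL)
  · filter_upwards [ae_mono (T.restrict_inner_le hL) hsnd,
      ae_restrict_mem L.measurableSet_inner] with x hx hxL
    exact hx.trans (gradient_eq_of_eqOn L.isOpen_inner hsum hxL)

end KernelSpace

/-! ### Cutting off inside `W` -/

section Cutoff

variable {d p : ℕ} {Ω : Set (EuclideanSpace ℝ (Fin d))}

theorem exists_sub_mem_kernelSpace (d p : ℕ) :
    ∃ C : ℝ, ∀ {Ω : Set (EuclideanSpace ℝ (Fin d))} (T : RectMesh Ω) {h : ℝ}, 0 < h →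
      (∀ K ∈ T.cells, ∀ i, h ≤ K.upper i - K.lower i) → ∀ u ∈ H10 Ω,
      ∃ z : L2Pair Ω, u - z ∈ T.kernelSpace p ∧ ∀ L ∈ T.cells,
        (L.IsPolyOrthogonal p u.fst →
          z.fst =ᵐ[volume.restrict L.inner] 0 ∧ z.snd =ᵐ[volume.restrict L.inner] 0) ∧
        ∫ x in L.inner, ‖z.snd x‖ ^ 2 ≤ (C * h⁻¹) ^ 2 * ∫ x in L.inner, u.fst x ^ 2 := by
  classical
  obtain ⟨C, hC⟩ := exists_bubble d p
  refine ⟨C, fun {Ω} T {h} hh hside u hu => ?_⟩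
  have hbubble := fun K hK => hC K h hh (hside K hK) u.fst
    ((Lp.memLp u.fst).mono_measure (T.restrict_inner_le hK))
  choose! b hb horth hzero hbound using hbubble
  obtain ⟨z, hz, hzb⟩ := T.exists_mem_H10_of_testFunctions hb
  refine ⟨z, T.mem_kernelSpace_iff.2 ⟨sub_mem hu hz, fun L hL q hq => ?_⟩, fun L hL => ⟨?_, ?_⟩⟩
  · rw [← horth L hL q hq]
    refine integral_congr_ae ?_
    filter_upwards [ae_mono (T.restrict_inner_le hL) (Lp.coeFn_sub u.fst z.fst),
      (hzb L hL).1] with x hx hzx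
    rw [WithLp.sub_fst, hx, Pi.sub_apply, hzx]
  · intro hLu
    have hgrad : ∇ (0 : EuclideanSpace ℝ (Fin d) → ℝ) = 0 := gradient_const' 0
    have h := hzb L hL
    rwa [hzero L hL hLu, hgrad] at h
  · refine le_of_eq_of_le (integral_congr_ae ?_) (hbound L hL)
    filter_upwards [(hzb L hL).2] with x hx
    rw [hx, norm_gradient]

theorem norm_add_sub_sq_le {F : Type*} [SeminormedAddCommGroup F] (a b c : F) :
    ‖a + b - c‖ ^ 2 ≤ 3 * (‖a‖ ^ 2 + ‖b‖ ^ 2 + ‖c‖ ^ 2) := by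
  have h : ‖a + b - c‖ ≤ ‖a‖ + ‖b‖ + ‖c‖ :=
    (norm_sub_le _ _).trans (add_le_add_left (norm_add_le a b) _)
  calc ‖a + b - c‖ ^ 2 ≤ (‖a‖ + ‖b‖ + ‖c‖) ^ 2 := by gcongr
    _ ≤ 3 * (‖a‖ ^ 2 + ‖b‖ ^ 2 + ‖c‖ ^ 2) := by
      linarith [sq_nonneg (‖a‖ - ‖b‖), sq_nonneg (‖a‖ - ‖c‖), sq_nonneg (‖b‖ - ‖c‖)]

theorem norm_smul_add_smul_sub_sq_le {F : Type*} [SeminormedAddCommGroup F] [NormedSpace ℝ F]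
    {s t M : ℝ} {a b c : F} (hs : |s| ≤ 1) (hb : ‖b‖ ≤ M) :
    ‖s • a + t • b - c‖ ^ 2 ≤ 3 * (‖a‖ ^ 2 + M ^ 2 * t ^ 2 + ‖c‖ ^ 2) := by
  refine (norm_add_sub_sq_le _ _ _).trans ?_
  simp only [norm_smul, mul_pow, Real.norm_eq_abs, sq_abs]
  rw [mul_comm (t ^ 2)]
  gcongr
  exact mul_le_of_le_one_left (sq_nonneg _) ((sq_le_one_iff_abs_le_one _).2 hs)

theorem smul_ae_eq_of_eqOn_const {η : EuclideanSpace ℝ (Fin d) → ℝ} {L : Rect d} {c : ℝ}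
    (hη : EqOn η (fun _ => c) L.inner) {ψ u : L2Pair Ω}
    (hfst : u.fst =ᵐ[volume.restrict L.inner] fun x => η x * ψ.fst x)
    (hsnd : u.snd =ᵐ[volume.restrict L.inner] fun x => η x • ψ.snd x + ψ.fst x • ∇ η x) :
    (u.fst =ᵐ[volume.restrict L.inner] fun x => c * ψ.fst x) ∧
      u.snd =ᵐ[volume.restrict L.inner] fun x => c • ψ.snd x := by
  constructor
  · filter_upwards [hfst, ae_restrict_mem L.measurableSet_inner] with x hx hxL
    rw [hx, hη hxL]
  · filter_upwards [hsnd, ae_restrict_mem L.measurableSet_inner] with x hx hxL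
    rw [hx, hη hxL, gradient_eq_of_eqOn L.isOpen_inner hη hxL, gradient_fun_const, smul_zero,
      add_zero]

theorem Rect.IsPolyOrthogonal.of_ae_eq_const_mul {L : Rect d}
    {f g : EuclideanSpace ℝ (Fin d) → ℝ} (hf : L.IsPolyOrthogonal p f) {c : ℝ}
    (hg : g =ᵐ[volume.restrict L.inner] fun x => c * f x) : L.IsPolyOrthogonal p g := by
  intro q hq
  calc ∫ x in L.inner, g x * MvPolynomial.eval (fun i => x i) q
      = ∫ x in L.inner, c * (f x * MvPolynomial.eval (fun i => x i) q) :=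
        integral_congr_ae (hg.mono fun x hx => by simp only [hx, mul_assoc])
    _ = 0 := by rw [integral_const_mul, hf q hq, mul_zero]

theorem integral_norm_sq_cutoff_le {X F : Type*} [MeasurableSpace X] {μ : Measure X}
    [NormedAddCommGroup F] [NormedSpace ℝ F] {η f u : X → ℝ} {g g' e z : X → F} {M P B : ℝ}
    (hη : ∀ x, |η x| ≤ 1) (he : ∀ x, ‖e x‖ ≤ M) (hf : MemLp f 2 μ) (hg : MemLp g 2 μ)
    (hz : MemLp z 2 μ) (hu : u =ᵐ[μ] fun x => η x * f x)
    (hg' : g' =ᵐ[μ] fun x => η x • g x + f x • e x - z x)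
    (hP : ∫ x, f x ^ 2 ∂μ ≤ P * ∫ x, ‖g x‖ ^ 2 ∂μ)
    (hB : ∫ x, ‖z x‖ ^ 2 ∂μ ≤ B ^ 2 * ∫ x, u x ^ 2 ∂μ) :
    ∫ x, ‖g' x‖ ^ 2 ∂μ ≤ 3 * (1 + (M ^ 2 + B ^ 2) * P) * ∫ x, ‖g x‖ ^ 2 ∂μ := by
  have hgi := hg.integrable_norm_pow two_ne_zero
  have hzi := hz.integrable_norm_pow two_ne_zero
  have hfi := hf.integrable_sq
  have huf : ∫ x, u x ^ 2 ∂μ ≤ ∫ x, f x ^ 2 ∂μ := by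
    refine integral_mono_of_nonneg (ae_of_all _ fun x => sq_nonneg _) hfi ?_
    filter_upwards [hu] with x hx
    rw [hx, mul_pow]
    exact mul_le_of_le_one_left (sq_nonneg _) ((sq_le_one_iff_abs_le_one _).2 (hη x))
  calc ∫ x, ‖g' x‖ ^ 2 ∂μ
      ≤ ∫ x, 3 * (‖g x‖ ^ 2 + M ^ 2 * f x ^ 2 + ‖z x‖ ^ 2) ∂μ := by
        refine integral_mono_of_nonneg (ae_of_all _ fun x => sq_nonneg _) (by fun_prop) ?_
        filter_upwards [hg'] with x hx
        exact hx ▸ norm_smul_add_smul_sub_sq_le (hη x) (he x)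
    _ = 3 * (∫ x, ‖g x‖ ^ 2 ∂μ + M ^ 2 * ∫ x, f x ^ 2 ∂μ + ∫ x, ‖z x‖ ^ 2 ∂μ) := by
        rw [integral_const_mul, integral_add (by fun_prop) hzi, integral_add hgi (by fun_prop),
          integral_const_mul]
    _ ≤ 3 * (∫ x, ‖g x‖ ^ 2 ∂μ + M ^ 2 * (P * ∫ x, ‖g x‖ ^ 2 ∂μ) +
          B ^ 2 * (P * ∫ x, ‖g x‖ ^ 2 ∂μ)) := by
        gcongr
        exact hB.trans (by gcongr; exact huf.trans hP)
    _ = 3 * (1 + (M ^ 2 + B ^ 2) * P) * ∫ x, ‖g x‖ ^ 2 ∂μ := by ring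

/-- On cells where `η` is constant, `η ψ` already has vanishing moments, so the correction that
brings it back to `W` vanishes there. -/
theorem exists_cutoff_kernelSpace (d p : ℕ) :
    ∃ C : ℝ, ∀ {Ω : Set (EuclideanSpace ℝ (Fin d))} (T : RectMesh Ω) {h D M : ℝ}, 0 < h →
      (∀ K ∈ T.cells, ∀ i, h ≤ K.upper i - K.lower i) →
      (∀ K ∈ T.cells, Metric.diam K.closed ≤ D) →
      ∀ η : EuclideanSpace ℝ (Fin d) → ℝ, ContDiff ℝ ∞ η → (∀ x, |η x| ≤ 1) →
      (∀ x, ‖fderiv ℝ η x‖ ≤ M) → ∀ ψ ∈ T.kernelSpace p, ∃ w ∈ T.kernelSpace p,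
      ∀ L ∈ T.cells,
        (∀ c : ℝ, EqOn η (fun _ => c) L.inner →
          (w.fst =ᵐ[volume.restrict L.inner] fun x => c * ψ.fst x) ∧
            w.snd =ᵐ[volume.restrict L.inner] fun x => c • ψ.snd x) ∧
        ∫ x in L.inner, ‖w.snd x‖ ^ 2 ≤
          3 * (1 + (M ^ 2 + (C * h⁻¹) ^ 2) * (2 ^ d * D ^ 2)) *
            ∫ x in L.inner, ‖ψ.snd x‖ ^ 2 := by
  obtain ⟨C, hC⟩ := exists_sub_mem_kernelSpace d p
  refine ⟨C, fun {Ω} T {h D M} hh hside hD η hη hη1 hηM ψ hψ => ?_⟩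
  obtain ⟨hψ₀, hψorth⟩ := T.mem_kernelSpace_iff.1 hψ
  obtain ⟨u, hu, hufst, husnd⟩ := exists_smul_mem_H10 hη hη1 hηM hψ₀
  obtain ⟨z, hz, hzL⟩ := hC T hh hside u hu
  refine ⟨u - z, hz, fun L hL => ?_⟩
  have hΩL := T.restrict_inner_le hL
  have hufstL := ae_mono hΩL hufst
  have husndL := ae_mono hΩL husnd
  have hwfst := ae_mono hΩL (Lp.coeFn_sub u.fst z.fst)
  have hwsnd := ae_mono hΩL (Lp.coeFn_sub u.snd z.snd)
  refine ⟨fun c hc => ?_, ?_⟩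
  · obtain ⟨hucfst, hucsnd⟩ := smul_ae_eq_of_eqOn_const hc hufstL husndL
    obtain ⟨hzfst, hzsnd⟩ := (hzL L hL).1 ((hψorth L hL).of_ae_eq_const_mul hucfst)
    constructor
    · filter_upwards [hwfst, hucfst, hzfst] with x hx hux hzx
      simpa only [WithLp.sub_fst, Pi.sub_apply, hux, hzx, Pi.zero_apply, sub_zero] using hx
    · filter_upwards [hwsnd, hucsnd, hzsnd] with x hx hux hzx
      simpa only [WithLp.sub_snd, Pi.sub_apply, hux, hzx, Pi.zero_apply, sub_zero] using hx
  · refine integral_norm_sq_cutoff_le hη1 (fun x => (norm_gradient η x).trans_le (hηM x))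
      ((Lp.memLp ψ.fst).mono_measure hΩL) ((Lp.memLp ψ.snd).mono_measure hΩL)
      ((Lp.memLp z.snd).mono_measure hΩL) hufstL ?_ ?_ (hzL L hL).2
    · filter_upwards [hwsnd, husndL] with x hx hux
      simpa only [WithLp.sub_snd, Pi.sub_apply, hux] using hx
    · refine (T.poincare_kernelSpace hψ hL).trans ?_
      gcongr
      exact hD L hL

end Cutoff

/-! ### Existence and uniqueness of the correction -/

section Existence

theorem existsUnique_mem_forall_apply_eq_of_coercive {V : Type*} [NormedAddCommGroup V]
    [InnerProductSpace ℝ V] [CompleteSpace V] {W : Submodule ℝ V} (hW : IsClosed (W : Set V))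
    (B : V →L[ℝ] V →L[ℝ] ℝ) {c : ℝ} (hc : 0 < c) (hB : ∀ u ∈ W, c * ‖u‖ * ‖u‖ ≤ B u u)
    (ℓ : V →L[ℝ] ℝ) : ∃! u, u ∈ W ∧ ∀ w ∈ W, B u w = ℓ w := by
  have hWc : CompleteSpace W := hW.completeSpace_coe
  have hcoercive : IsCoercive (B.bilinearComp W.subtypeL W.subtypeL) := ⟨c, hc, fun u => hB u u.2⟩
  let φ := (InnerProductSpace.toDual ℝ W).symm (ℓ.comp W.subtypeL)
  have hφ : ∀ w : W, inner ℝ φ w = ℓ w := fun w => InnerProductSpace.toDual_symm_apply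
  refine ⟨hcoercive.continuousLinearEquivOfBilin.symm φ, ⟨Subtype.prop _, fun w hw => ?_⟩,
    fun u hu => ?_⟩
  · have h := hcoercive.continuousLinearEquivOfBilin_apply
      (hcoercive.continuousLinearEquivOfBilin.symm φ) ⟨w, hw⟩
    rw [ContinuousLinearEquiv.apply_symm_apply, hφ] at h
    exact h.symm
  · refine congrArg Subtype.val (a₁ := (⟨u, hu.1⟩ : W)) ?_
    rw [ContinuousLinearEquiv.eq_symm_apply]
    refine (hcoercive.unique_continuousLinearEquivOfBilin fun w => ?_).symm
    exact (hφ w).trans (hu.2 w w.2).symm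

variable {d p : ℕ} {Ω : Set (EuclideanSpace ℝ (Fin d))} {A : EuclideanSpace ℝ (Fin d) → ℝ}

theorem exists_clm_apply_eq_energyForm (hA : MemLp A ⊤ (volume.restrict Ω)) :
    ∃ B : L2Pair Ω →L[ℝ] L2Pair Ω →L[ℝ] ℝ, ∀ u w, B u w = energyForm A u w := by
  obtain ⟨M, hM⟩ := exists_clm_coeFn_eq_bilin
    (ContinuousLinearMap.lsmul ℝ ℝ : ℝ →L[ℝ] EuclideanSpace ℝ (Fin d) →L[ℝ] _) hA
  let grad := WithLp.sndL 2 ℝ (L2 Ω) (Lp (EuclideanSpace ℝ (Fin d)) 2 (volume.restrict Ω))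
  refine ⟨(innerSL ℝ).bilinearComp (M.comp grad) grad, fun u w => ?_⟩
  calc inner ℝ (M u.snd) w.snd = ∫ x in Ω, inner ℝ (M u.snd x) (w.snd x) := L2.inner_def _ _
    _ = energyForm A u w := integral_congr_ae <| (hM u.snd).mono fun x hx => by
        simp only [hx, ContinuousLinearMap.lsmul_apply, real_inner_smul_left]

theorem integrable_mul_inner (hA : MemLp A ⊤ (volume.restrict Ω)) (u w : L2Pair Ω) :
    IntegrableOn (fun x => A x * inner ℝ (u.snd x) (w.snd x)) Ω :=
  memLp_one_iff_integrable.1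
    ((memLp_one_iff_integrable.2 (L2.integrable_inner (𝕜 := ℝ) u.snd w.snd)).mul hA)

theorem mul_norm_sq_le_energyForm_self (hA : MemLp A ⊤ (volume.restrict Ω)) {α : ℝ}
    (hαA : ∀ᵐ x ∂volume.restrict Ω, α ≤ A x) (u : L2Pair Ω) :
    α * ‖u.snd‖ ^ 2 ≤ energyForm A u u := by
  rw [← integral_norm_sq_eq_norm_sq, ← integral_const_mul]
  refine integral_mono_ae ((integrable_norm_sq u.snd).const_mul _) (integrable_mul_inner hA u u) ?_
  filter_upwards [hαA] with x hx
  rw [real_inner_self_eq_norm_sq]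
  gcongr

theorem RectMesh.exists_norm_sq_le_mul_norm_snd_sq (T : RectMesh Ω) (p : ℕ) :
    ∃ C > 0, ∀ w ∈ T.kernelSpace p, ‖w‖ ^ 2 ≤ C * ‖w.snd‖ ^ 2 := by
  refine ⟨∑ K ∈ T.cells, 2 ^ d * Metric.diam K.closed ^ 2 + 1, by positivity, fun w hw => ?_⟩
  rw [WithLp.prod_norm_sq_eq_of_L2, add_one_mul]
  gcongr
  have hfst := integrable_norm_sq w.fst
  rw [← integral_norm_sq_eq_norm_sq w.fst, T.integral_eq_sum hfst, Finset.sum_mul]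
  simp only [Real.norm_eq_abs, sq_abs]
  refine Finset.sum_le_sum fun K hK => (T.poincare_kernelSpace hw hK).trans ?_
  gcongr
  rw [← integral_norm_sq_eq_norm_sq]
  exact setIntegral_mono_set (integrable_norm_sq w.snd) (ae_of_all _ fun x => sq_nonneg _)
    (T.inner_subset K hK).eventuallyLE

theorem RectMesh.isClosed_kernelSpace (T : RectMesh Ω) (p : ℕ) :
    IsClosed (T.kernelSpace p : Set (L2Pair Ω)) := by
  have hproj : Continuous fun z : L2Pair Ω => T.l2Proj p z.fst := by fun_prop
  exact (Submodule.isClosed_topologicalClosure _).inter (isClosed_singleton.preimage hproj)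

theorem exists_clm_apply_eq_neg_setIntegral_mul (v : L2 Ω) {s : Set (EuclideanSpace ℝ (Fin d))}
    (hs : MeasurableSet s) :
    ∃ ℓ : L2Pair Ω →L[ℝ] ℝ, ∀ w, ℓ w = -∫ x in Ω ∩ s, v x * w.fst x := by
  have hv : MemLp (s.indicator v) 2 (volume.restrict Ω) := (Lp.memLp v).indicator hs
  refine ⟨-(innerSL ℝ hv.toLp).comp (WithLp.fstL 2 ℝ _ _), fun w => congrArg Neg.neg ?_⟩
  rw [inter_comm, ← Measure.restrict_restrict hs, ← integral_indicator hs]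
  refine (L2.inner_def (𝕜 := ℝ) hv.toLp w.fst).trans (integral_congr_ae ?_)
  filter_upwards [hv.coeFn_toLp] with x hx
  by_cases hxs : x ∈ s <;> simp [hx, hxs, mul_comm]

theorem RectMesh.existsUnique_isEnrichedCorrection (T : RectMesh Ω) (p : ℕ)
    (hA : MemLp A ⊤ (volume.restrict Ω)) {α : ℝ} (hα : 0 < α)
    (hαA : ∀ᵐ x ∂volume.restrict Ω, α ≤ A x) (G : Rect d) (v : L2 Ω) :
    ∃! ψ, T.IsEnrichedCorrection p A G v ψ := by
  obtain ⟨B, hB⟩ := exists_clm_apply_eq_energyForm hA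
  obtain ⟨ℓ, hℓ⟩ := exists_clm_apply_eq_neg_setIntegral_mul v G.isClosed_closed.measurableSet
  obtain ⟨C, hC, hnorm⟩ := T.exists_norm_sq_le_mul_norm_snd_sq p
  have hcoercive : ∀ u ∈ T.kernelSpace p, α / C * ‖u‖ * ‖u‖ ≤ B u u := fun u hu =>
    calc α / C * ‖u‖ * ‖u‖ = α / C * ‖u‖ ^ 2 := by ring
      _ ≤ α / C * (C * ‖u.snd‖ ^ 2) := by gcongr; exact hnorm u hu
      _ = α * ‖u.snd‖ ^ 2 := by field_simp
      _ ≤ energyForm A u u := mul_norm_sq_le_energyForm_self hA hαA u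
      _ = B u u := (hB u u).symm
  simpa only [RectMesh.IsEnrichedCorrection, hB, hℓ] using
    existsUnique_mem_forall_apply_eq_of_coercive (T.isClosed_kernelSpace p) B (div_pos hα hC)
      hcoercive ℓ

end Existence

/-! ### Decay of the correction -/

section Decay

variable {d p : ℕ} {Ω : Set (EuclideanSpace ℝ (Fin d))} {A : EuclideanSpace ℝ (Fin d) → ℝ}

open Classical in
/-- The energy of `∇ψ` in the cells of the mesh that do not belong to `S`. -/
noncomputable def RectMesh.energyOff (T : RectMesh Ω) (ψ : L2Pair Ω) (S : Finset (Rect d)) : ℝ :=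
  ∑ K ∈ T.cells \ S, ∫ x in K.inner, ‖ψ.snd x‖ ^ 2

theorem setIntegral_norm_snd_sq_nonneg (ψ : L2Pair Ω) (s : Set (EuclideanSpace ℝ (Fin d))) :
    0 ≤ ∫ x in s, ‖ψ.snd x‖ ^ 2 :=
  integral_nonneg fun _ => sq_nonneg _

theorem RectMesh.energyOff_nonneg (T : RectMesh Ω) (ψ : L2Pair Ω) (S : Finset (Rect d)) :
    0 ≤ T.energyOff ψ S :=
  Finset.sum_nonneg fun _ _ => setIntegral_norm_snd_sq_nonneg ψ _

open Classical in
theorem RectMesh.energyOff_antitone (T : RectMesh Ω) (ψ : L2Pair Ω) : Antitone (T.energyOff ψ) :=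
  fun _ _ h => Finset.sum_le_sum_of_subset_of_nonneg (Finset.sdiff_subset_sdiff le_rfl h)
    fun _ _ _ => setIntegral_norm_snd_sq_nonneg ψ _

open Classical in
theorem RectMesh.energyOff_le (T : RectMesh Ω) (ψ : L2Pair Ω) (S : Finset (Rect d)) :
    T.energyOff ψ S ≤ ∫ x in Ω, ‖ψ.snd x‖ ^ 2 := by
  rw [T.integral_eq_sum (integrable_norm_sq ψ.snd)]
  exact Finset.sum_le_sum_of_subset_of_nonneg Finset.sdiff_subset
    fun _ _ _ => setIntegral_norm_snd_sq_nonneg ψ _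

open Classical in
theorem RectMesh.energyOff_sub_energyOff (T : RectMesh Ω) (ψ : L2Pair Ω) {S S' : Finset (Rect d)}
    (hSS' : S ⊆ S') (hS' : S' ⊆ T.cells) :
    T.energyOff ψ S - T.energyOff ψ S' = ∑ K ∈ S' \ S, ∫ x in K.inner, ‖ψ.snd x‖ ^ 2 := by
  have hsdiff : (T.cells \ S) \ (S' \ S) = T.cells \ S' := by
    rw [sdiff_sdiff_sdiff_cancel_right hSS']
  rw [sub_eq_iff_eq_add', RectMesh.energyOff, RectMesh.energyOff, ← hsdiff,
    Finset.sum_sdiff (Finset.sdiff_subset_sdiff hS' le_rfl)]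

theorem RectMesh.setIntegral_diff_cellUnion_le_energyOff (T : RectMesh Ω) (ψ : L2Pair Ω)
    (S : Finset (Rect d)) :
    ∫ x in Ω \ cellUnion S, ‖ψ.snd x‖ ^ 2 ≤ T.energyOff ψ S := by
  classical
  have hmeas := (isClosed_cellUnion S).measurableSet.compl
  have hint := integrable_norm_sq ψ.snd
  rw [sdiff_eq, inter_comm, ← Measure.restrict_restrict hmeas, ← integral_indicator hmeas,
    T.integral_eq_sum (hint.indicator hmeas), RectMesh.energyOff, ← Finset.filter_notMem_eq_sdiff,
    Finset.sum_filter]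
  simp only [ite_not]
  refine Finset.sum_le_sum fun K hK => ?_
  split_ifs with hKS
  · refine (setIntegral_eq_zero_of_forall_eq_zero fun x hx => indicator_of_notMem ?_ _).le
    exact not_not.2 (mem_cellUnion.2 ⟨K, hKS, K.inner_subset_closed hx⟩)
  · exact integral_mono_of_nonneg
      (ae_of_all _ (indicator_nonneg fun _ _ => sq_nonneg _))
      (hint.mono_measure (T.restrict_inner_le hK))
      (ae_of_all _ (indicator_le_self' fun _ _ => sq_nonneg _))

theorem neg_integral_mul_inner_le {X F : Type*} [MeasurableSpace X] {μ : Measure X}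
    [NormedAddCommGroup F] [InnerProductSpace ℝ F] {a : X → ℝ} {f g : X → F} {β : ℝ}
    (ha : ∀ᵐ x ∂μ, |a x| ≤ β) (hf : MemLp f 2 μ) (hg : MemLp g 2 μ) :
    -∫ x, a x * inner ℝ (f x) (g x) ∂μ ≤
      β / 2 * (∫ x, ‖f x‖ ^ 2 ∂μ + ∫ x, ‖g x‖ ^ 2 ∂μ) := by
  have hf2 := hf.integrable_norm_pow two_ne_zero
  have hg2 := hg.integrable_norm_pow two_ne_zero
  rw [← integral_add hf2 hg2, ← integral_const_mul]
  have hbound : Integrable (fun x => β / 2 * (‖f x‖ ^ 2 + ‖g x‖ ^ 2)) μ :=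
    (hf2.add hg2).const_mul _
  refine (neg_le_abs _).trans ?_
  rw [← Real.norm_eq_abs]
  refine norm_integral_le_of_norm_le hbound ?_
  filter_upwards [ha] with x hx
  have hβ : 0 ≤ β := (abs_nonneg _).trans hx
  calc ‖a x * inner ℝ (f x) (g x)‖ = |a x| * |inner ℝ (f x) (g x)| := abs_mul _ _
    _ ≤ β * (‖f x‖ * ‖g x‖) := by gcongr; exact abs_real_inner_le_norm _ _
    _ ≤ β * ((‖f x‖ ^ 2 + ‖g x‖ ^ 2) / 2) := by
        gcongr
        linarith [two_mul_le_add_sq ‖f x‖ ‖g x‖]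
    _ = β / 2 * (‖f x‖ ^ 2 + ‖g x‖ ^ 2) := by ring

theorem RectMesh.mul_energyOff_le_of_energyForm_eq_zero (T : RectMesh Ω)
    (hA : MemLp A ⊤ (volume.restrict Ω)) {α β Q : ℝ}
    (hαβ : ∀ᵐ x ∂volume.restrict Ω, α ≤ A x ∧ |A x| ≤ β) (hβ : 0 ≤ β) {ψ w : L2Pair Ω}
    (hψw : energyForm A ψ w = 0) {S S' : Finset (Rect d)} (hSS' : S ⊆ S') (hS' : S' ⊆ T.cells)
    (hnear : ∀ L ∈ S, w.snd =ᵐ[volume.restrict L.inner] 0)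
    (hfar : ∀ L ∈ T.cells, L ∉ S' → w.snd =ᵐ[volume.restrict L.inner] ψ.snd)
    (hring : ∀ L ∈ S', ∫ x in L.inner, ‖w.snd x‖ ^ 2 ≤ Q * ∫ x in L.inner, ‖ψ.snd x‖ ^ 2) :
    α * T.energyOff ψ S' ≤ β / 2 * (1 + Q) * (T.energyOff ψ S - T.energyOff ψ S') := by
  classical
  let a : Rect d → ℝ := fun L => ∫ x in L.inner, A x * inner ℝ (ψ.snd x) (w.snd x)
  have hsum : ∑ L ∈ T.cells \ S', a L + (∑ L ∈ S' \ S, a L + ∑ L ∈ S, a L) = 0 := by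
    rw [Finset.sum_sdiff hSS', Finset.sum_sdiff hS', ← hψw]
    exact (T.integral_eq_sum (integrable_mul_inner hA ψ w)).symm
  have hzero : ∑ L ∈ S, a L = 0 := Finset.sum_eq_zero fun L hL => integral_eq_zero_of_ae <| by
    filter_upwards [hnear L hL] with x hx
    simp only [hx, Pi.zero_apply, inner_zero_right, mul_zero]
  have hlower : ∀ L ∈ T.cells \ S', α * ∫ x in L.inner, ‖ψ.snd x‖ ^ 2 ≤ a L := fun L hL => by
    obtain ⟨hL, hLS'⟩ := Finset.mem_sdiff.1 hL
    have hΩL := T.restrict_inner_le hL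
    rw [← integral_const_mul]
    refine integral_mono_ae (((integrable_norm_sq ψ.snd).mono_measure hΩL).const_mul _)
      (Integrable.mono_measure (integrable_mul_inner hA ψ w) hΩL) ?_
    filter_upwards [hfar L hL hLS', ae_mono hΩL hαβ] with x hx hαx
    rw [hx, real_inner_self_eq_norm_sq]
    gcongr
    exact hαx.1
  have hupper : ∀ L ∈ S' \ S, -a L ≤ β / 2 * (1 + Q) * ∫ x in L.inner, ‖ψ.snd x‖ ^ 2 :=
    fun L hL => by
    have hLS' := Finset.sdiff_subset hL
    have hΩL := T.restrict_inner_le (hS' hLS')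
    refine (neg_integral_mul_inner_le (ae_mono hΩL (hαβ.mono fun x hx => hx.2))
      ((Lp.memLp ψ.snd).mono_measure hΩL) ((Lp.memLp w.snd).mono_measure hΩL)).trans ?_
    rw [mul_assoc, one_add_mul]
    gcongr
    exact hring L hLS'
  calc α * T.energyOff ψ S' ≤ ∑ L ∈ T.cells \ S', a L := by
        rw [RectMesh.energyOff, Finset.mul_sum]
        exact Finset.sum_le_sum hlower
    _ = ∑ L ∈ S' \ S, -a L := by rw [Finset.sum_neg_distrib]; linarith
    _ ≤ β / 2 * (1 + Q) * (T.energyOff ψ S - T.energyOff ψ S') := by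
        rw [T.energyOff_sub_energyOff ψ hSS' hS', Finset.mul_sum]
        exact Finset.sum_le_sum hupper

theorem RectMesh.le_mul_side {T : RectMesh Ω} {σ κ H : ℝ} (hσ : T.ShapeRegular σ)
    (hκ : T.QuasiUniform κ H) {K : Rect d} (hK : K ∈ T.cells) (i : Fin d) :
    H ≤ max κ 1 * max σ 1 * (K.upper i - K.lower i) := by
  have hside := (K.side_pos i).le
  calc H ≤ κ * Metric.diam K.closed := (hκ K hK).2
    _ ≤ max κ 1 * (max σ 1 * (K.upper i - K.lower i)) := by
        gcongr
        · exact le_max_left _ _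
        · exact (hσ K hK i).trans (by gcongr; exact le_max_left _ _)
    _ = max κ 1 * max σ 1 * (K.upper i - K.lower i) := (mul_assoc _ _ _).symm

theorem RectMesh.isBounded_closure (T : RectMesh Ω) : Bornology.IsBounded (closure Ω) := by
  rw [T.closure_eq]
  exact (T.cells.isCompact_biUnion fun K _ => K.isCompact_closed).isBounded

theorem RectMesh.le_mul_diam_closure {T : RectMesh Ω} {κ H : ℝ} (hκ : T.QuasiUniform κ H)
    {K : Rect d} (hK : K ∈ T.cells) : H ≤ max κ 1 * Metric.diam (closure Ω) := by
  refine (hκ K hK).2.trans ?_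
  gcongr
  · exact le_max_left _ _
  · exact Metric.diam_mono (T.closed_subset_closure hK) T.isBounded_closure

theorem exists_pos_forall_dist_lt_mul_mem_iterate_grow (Ω : Set (EuclideanSpace ℝ (Fin d)))
    (σ κ : ℝ) :
    ∃ θ > 0, ∀ (T : RectMesh Ω) (H : ℝ), 0 < H → T.ShapeRegular σ → T.QuasiUniform κ H →
      (∀ K ∈ T.cells, ∀ i, θ * H ≤ K.upper i - K.lower i) ∧
      ∀ S ⊆ T.cells, ∀ x ∈ cellUnion S, ∀ y ∈ closure Ω, dist x y < θ * H →
        y ∈ cellUnion (T.grow^[2 * 2 ^ d] S) := by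
  by_cases hΩ : Nonempty (RectMesh Ω)
  swap
  · exact ⟨1, one_pos, fun T => absurd ⟨T⟩ hΩ⟩
  obtain ⟨T₀⟩ := hΩ
  obtain ⟨δ, hδ, hδgrow⟩ := T₀.exists_pos_forall_dist_lt_mem_iterate_grow
  have hκ1 : 0 < max κ 1 := lt_max_of_lt_right one_pos
  have hσ1 : 0 < max σ 1 := lt_max_of_lt_right one_pos
  have hdiam : 0 < Metric.diam (closure Ω) + 1 := by positivity
  obtain ⟨θ, hθ, hθside, hθδ⟩ : ∃ θ > 0, θ ≤ (max κ 1 * max σ 1)⁻¹ ∧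
      θ ≤ δ / (max κ 1 * (Metric.diam (closure Ω) + 1)) :=
    ⟨_, lt_min (inv_pos.2 (mul_pos hκ1 hσ1)) (div_pos hδ (mul_pos hκ1 hdiam)),
      min_le_left _ _, min_le_right _ _⟩
  refine ⟨θ, hθ, fun T H hH hσ hκ => ?_⟩
  have hside : ∀ K ∈ T.cells, ∀ i, θ * H ≤ K.upper i - K.lower i := fun K hK i =>
    calc θ * H ≤ (max κ 1 * max σ 1)⁻¹ * H := by gcongr
      _ ≤ K.upper i - K.lower i :=
        (inv_mul_le_iff₀ (mul_pos hκ1 hσ1)).2 (RectMesh.le_mul_side hσ hκ hK i)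
  refine ⟨hside, fun S hS x hx y hy hxy => ?_⟩
  refine hδgrow T _ hside S hS x hx y hy (hxy.trans_le ?_) hxy
  obtain ⟨K, hK, -⟩ := mem_cellUnion.1 hx
  have hH_le : H ≤ max κ 1 * (Metric.diam (closure Ω) + 1) :=
    (RectMesh.le_mul_diam_closure hκ (hS hK)).trans (by gcongr; exact (lt_add_one _).le)
  calc θ * H ≤ θ * (max κ 1 * (Metric.diam (closure Ω) + 1)) := by gcongr
    _ ≤ δ := (le_div_iff₀ (mul_pos hκ1 hdiam)).1 hθδ

theorem RectMesh.exists_cutoff_layers (T : RectMesh Ω) {ρ : ℝ} (hρ : 0 < ρ) {n : ℕ}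
    {S : Finset (Rect d)}
    (hS : ∀ x ∈ cellUnion S, ∀ y ∈ closure Ω, dist x y < ρ → y ∈ cellUnion (T.grow^[n] S)) :
    ∃ η : EuclideanSpace ℝ (Fin d) → ℝ, ContDiff ℝ ∞ η ∧ (∀ x, |η x| ≤ 1) ∧
      (∀ x, ‖fderiv ℝ η x‖ ≤ 2 / ρ) ∧ (∀ L ∈ S, EqOn η (fun _ => 0) L.inner) ∧
      ∀ L ∈ T.cells, L ∉ T.grow^[n + 1] S → EqOn η (fun _ => 1) L.inner := by
  classical
  obtain ⟨η, hη, hη1, hone, hzero, hηρ⟩ :=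
    exists_smooth_cutoff (cellUnion (T.cells \ T.grow^[n + 1] S)) hρ
  refine ⟨η, hη, hη1, hηρ, fun L hL x hx => hzero x fun hthick => ?_, fun L hL hLS x hx =>
    hone x (mem_cellUnion.2 ⟨L, Finset.mem_sdiff.2 ⟨hL, hLS⟩, L.inner_subset_closed hx⟩)⟩
  obtain ⟨y, hy, hxy⟩ := Metric.mem_thickening_iff.1 hthick
  obtain ⟨K, hK, hyK⟩ := mem_cellUnion.1 hy
  obtain ⟨hK, hKS⟩ := Finset.mem_sdiff.1 hK
  rw [Function.iterate_succ_apply'] at hKS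
  exact hKS (T.mem_grow.2 ⟨hK, y, hS x (mem_cellUnion.2 ⟨L, hL, L.inner_subset_closed hx⟩) y
    (T.closed_subset_closure hK hyK) hxy, hyK⟩)

theorem exists_kernelSpace_cutoff_layers (p : ℕ) (Ω : Set (EuclideanSpace ℝ (Fin d))) (σ κ : ℝ) :
    ∃ Q > 0, ∀ (T : RectMesh Ω) (H : ℝ), 0 < H → T.ShapeRegular σ → T.QuasiUniform κ H →
      ∀ S ⊆ T.cells, ∀ ψ ∈ T.kernelSpace p, ∃ w ∈ T.kernelSpace p,
      (∀ L ∈ S, w.fst =ᵐ[volume.restrict L.inner] 0 ∧ w.snd =ᵐ[volume.restrict L.inner] 0) ∧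
      (∀ L ∈ T.cells, L ∉ T.grow^[2 * 2 ^ d + 1] S →
        w.snd =ᵐ[volume.restrict L.inner] ψ.snd) ∧
      ∀ L ∈ T.cells, ∫ x in L.inner, ‖w.snd x‖ ^ 2 ≤ Q * ∫ x in L.inner, ‖ψ.snd x‖ ^ 2 := by
  obtain ⟨θ, hθ, hgeom⟩ := exists_pos_forall_dist_lt_mul_mem_iterate_grow Ω σ κ
  obtain ⟨C, hC⟩ := exists_cutoff_kernelSpace d p
  refine ⟨3 * (1 + ((2 / θ) ^ 2 + (C / θ) ^ 2) * 2 ^ d), by positivity,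
    fun T H hH hσ hκ S hS ψ hψ => ?_⟩
  obtain ⟨hside, hgrow⟩ := hgeom T H hH hσ hκ
  have hθH : 0 < θ * H := mul_pos hθ hH
  obtain ⟨η, hη, hη1, hηρ, hzero, hone⟩ := T.exists_cutoff_layers hθH (hgrow S hS)
  obtain ⟨w, hw, hwL⟩ := hC T hθH hside (fun K hK => (hκ K hK).1) η hη hη1 hηρ ψ hψ
  refine ⟨w, hw, fun L hL => ?_, fun L hL hLS => ?_, fun L hL => ?_⟩
  · obtain ⟨hfst, hsnd⟩ := (hwL L (hS hL)).1 0 (hzero L hL)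
    simp only [zero_mul, zero_smul] at hfst hsnd
    exact ⟨hfst, hsnd⟩
  · simpa only [one_smul] using ((hwL L hL).1 1 (hone L hL hLS)).2
  · refine (hwL L hL).2.trans_eq ?_
    field_simp

theorem RectMesh.IsEnrichedCorrection.energyForm_eq_zero {T : RectMesh Ω} {G : Rect d}
    {v : L2 Ω} {ψ w : L2Pair Ω} (hψ : T.IsEnrichedCorrection p A G v ψ)
    (hG : G ∈ T.cells) (hw : w ∈ T.kernelSpace p) (hwG : w.fst =ᵐ[volume.restrict G.inner] 0) :
    energyForm A ψ w = 0 := by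
  rw [hψ.2 w hw, neg_eq_zero, inter_comm,
    ← Measure.restrict_restrict G.isClosed_closed.measurableSet, T.restrict_restrict_closed hG]
  refine integral_eq_zero_of_ae ?_
  filter_upwards [hwG] with x hx
  rw [hx, Pi.zero_apply, mul_zero]

/-- Testing with a cutoff of `ψ` bounds the energy far from `G` by the energy of an intermediate
ring; adding the far energy to both sides ("hole filling") turns this into a contraction. -/
theorem exists_energyOff_contraction (p : ℕ) (Ω : Set (EuclideanSpace ℝ (Fin d))) {α β : ℝ}
    (hα : 0 < α) (hβ : 0 < β) (σ κ : ℝ) :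
    ∃ q ∈ Ioo (0 : ℝ) 1, ∀ A : EuclideanSpace ℝ (Fin d) → ℝ, MemLp A ⊤ (volume.restrict Ω) →
      (∀ᵐ x ∂volume.restrict Ω, α ≤ A x ∧ |A x| ≤ β) →
      ∀ (T : RectMesh Ω) (H : ℝ), 0 < H → T.ShapeRegular σ → T.QuasiUniform κ H →
      ∀ G ∈ T.cells, ∀ v ψ, T.IsEnrichedCorrection p A G v ψ → ∀ m : ℕ,
        T.energyOff ψ (T.grow^[m + (2 * 2 ^ d + 1)] {G}) ≤
          q * T.energyOff ψ (T.grow^[m] {G}) := by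
  obtain ⟨Q, hQ, hcut⟩ := exists_kernelSpace_cutoff_layers p Ω σ κ
  have : 0 < β / 2 * (1 + Q) := by positivity
  refine ⟨β / 2 * (1 + Q) / (α + β / 2 * (1 + Q)),
    ⟨by positivity, (div_lt_one (by positivity)).2 (lt_add_of_pos_left _ hα)⟩,
    fun A hA hαβ T H hH hσ hκ G hG v ψ hψ m => ?_⟩
  have hGT : {G} ⊆ T.cells := Finset.singleton_subset_iff.2 hG
  have hmono := T.monotone_iterate_grow hGT
  obtain ⟨w, hw, hnear, hfar, hring⟩ :=
    hcut T H hH hσ hκ _ (T.iterate_grow_subset_cells hGT m) ψ hψ.1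
  have hGm : G ∈ T.grow^[m] {G} := hmono (Nat.zero_le m) (Finset.mem_singleton_self G)
  rw [← Function.iterate_add_apply, add_comm _ m] at hfar
  have hS' := T.iterate_grow_subset_cells hGT (m + (2 * 2 ^ d + 1))
  have hstep := T.mul_energyOff_le_of_energyForm_eq_zero hA hαβ hβ.le
    (hψ.energyForm_eq_zero hG hw (hnear G hGm).1) (hmono (Nat.le_add_right m _)) hS'
    (fun L hL => (hnear L hL).2) hfar fun L hL => hring L (hS' hL)
  rw [div_mul_eq_mul_div, le_div_iff₀ (by positivity)]
  linarith

theorem le_pow_mul_of_forall_add_le_mul {E : ℕ → ℝ} {q : ℝ} (hq : 0 ≤ q) {r : ℕ}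
    (hE : ∀ m, E (m + r) ≤ q * E m) (j : ℕ) : E (j * r) ≤ q ^ j * E 0 := by
  induction j with
  | zero => simp
  | succ j ih =>
    calc E ((j + 1) * r) = E (j * r + r) := by rw [add_one_mul]
      _ ≤ q * E (j * r) := hE _
      _ ≤ q * (q ^ j * E 0) := by gcongr
      _ = q ^ (j + 1) * E 0 := by ring

theorem exists_sqrt_le_exp_mul_sqrt {q : ℝ} (hq : q ∈ Ioo (0 : ℝ) 1) {r : ℕ} (hr : 0 < r) :
    ∃ c C : ℝ, 0 < c ∧ 0 < C ∧ ∀ E : ℕ → ℝ, Antitone E → 0 ≤ E 0 →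
      (∀ m, E (m + r) ≤ q * E m) → ∀ k : ℕ, √(E k) ≤ C * Real.exp (-c * k) * √(E 0) := by
  obtain ⟨hq0, hq1⟩ := hq
  have : (0 : ℝ) < r := Nat.cast_pos.2 hr
  have hlog : Real.log q < 0 := Real.log_neg hq0 hq1
  refine ⟨-Real.log q / (2 * r), √q⁻¹, div_pos (neg_pos.2 hlog) (by positivity),
    Real.sqrt_pos.2 (inv_pos.2 hq0), fun E hanti hE0 hE k => ?_⟩
  have hfloor : (k : ℝ) / r ≤ (k / r : ℕ) + 1 := by
    rw [← Nat.floor_div_eq_div (K := ℝ)]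
    exact (Nat.lt_floor_add_one _).le
  have hpow : q ^ (k / r) ≤ q⁻¹ * Real.exp (Real.log q / r * k) := by
    rw [← Real.exp_log hq0, ← Real.exp_nat_mul, ← Real.exp_neg, ← Real.exp_add, Real.exp_log hq0,
      Real.exp_le_exp, div_mul_eq_mul_div, mul_div_assoc]
    linarith [mul_le_mul_of_nonpos_left hfloor hlog.le]
  have hexp : Real.exp (-(-Real.log q / (2 * r)) * k) = √(Real.exp (Real.log q / r * k)) := by
    rw [← Real.exp_half]
    congr 1
    field_simp
  rw [hexp, ← Real.sqrt_mul (by positivity), ← Real.sqrt_mul (by positivity)]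
  refine Real.sqrt_le_sqrt ?_
  calc E k ≤ E (k / r * r) := hanti (Nat.div_mul_le_self k r)
    _ ≤ q ^ (k / r) * E 0 := le_pow_mul_of_forall_add_le_mul hq0.le hE _
    _ ≤ q⁻¹ * Real.exp (Real.log q / r * k) * E 0 := by gcongr

end Decay

end LOD

theorem mainTheorem4_general (d p : ℕ) (Ω : Set (EuclideanSpace ℝ (Fin d))) (α β : ℝ)
    (hα : 0 < α) (σ κ : ℝ) :
    ∃ c C : ℝ, 0 < c ∧ 0 < C ∧
      ∀ A : EuclideanSpace ℝ (Fin d) → ℝ,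
        AEStronglyMeasurable A (volume.restrict Ω) →
        (∀ᵐ x ∂volume.restrict Ω, α ≤ A x ∧ A x ≤ β) →
      ∀ (T : LOD.RectMesh Ω) (H : ℝ), 0 < H → T.ShapeRegular σ → T.QuasiUniform κ H →
      ∀ G ∈ T.cells, ∀ v : LOD.L2 Ω,
        (∃! ψ : LOD.L2Pair Ω, T.IsEnrichedCorrection p A G v ψ) ∧
        ∀ ψ : LOD.L2Pair Ω, T.IsEnrichedCorrection p A G v ψ →
          ∀ k : ℕ, LOD.gradNormOn (Ω \ T.patch k G.closed) ψ
            ≤ C * Real.exp (-c * k) * LOD.gradNormOn Ω ψ := by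
  obtain ⟨q, hq, hcontract⟩ :=
    LOD.exists_energyOff_contraction p Ω hα (lt_max_of_lt_left hα : 0 < max α β) σ κ
  obtain ⟨c, C, hc, hC, hdecay⟩ := LOD.exists_sqrt_le_exp_mul_sqrt hq (2 * 2 ^ d).succ_pos
  refine ⟨c, C, hc, hC, fun A hAm hAb T H hH hσ hκ G hG v => ?_⟩
  have hαβ : ∀ᵐ x ∂volume.restrict Ω, α ≤ A x ∧ |A x| ≤ max α β := by
    filter_upwards [hAb] with x hx
    rw [abs_of_nonneg (hα.le.trans hx.1)]
    exact ⟨hx.1, hx.2.trans (le_max_right _ _)⟩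
  have hA : MemLp A ⊤ (volume.restrict Ω) :=
    memLp_top_of_bound hAm (max α β) (hαβ.mono fun _ hx => hx.2)
  refine ⟨T.existsUnique_isEnrichedCorrection p hA hα (hAb.mono fun _ hx => hx.1) G v,
    fun ψ hψ k => ?_⟩
  have hanti : Antitone fun k => T.energyOff ψ (T.grow^[k] {G}) :=
    (T.energyOff_antitone ψ).comp_monotone
      (T.monotone_iterate_grow (Finset.singleton_subset_iff.2 hG))
  calc LOD.gradNormOn (Ω \ T.patch k G.closed) ψ ≤ √(T.energyOff ψ (T.grow^[k] {G})) := by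
        rw [T.patch_closed_eq]
        exact Real.sqrt_le_sqrt (T.setIntegral_diff_cellUnion_le_energyOff ψ _)
    _ ≤ C * Real.exp (-c * k) * √(T.energyOff ψ {G}) :=
        hdecay _ hanti (T.energyOff_nonneg ψ _) (hcontract A hA hαβ T H hH hσ hκ G hG v ψ hψ) k
    _ ≤ C * Real.exp (-c * k) * LOD.gradNormOn Ω ψ := by
        gcongr
        exact Real.sqrt_le_sqrt (T.energyOff_le ψ _)

theorem mainTheorem4 (d : ℕ) (hd : 1 ≤ d) (p : ℕ)
    (Ω : Set (EuclideanSpace ℝ (Fin d))) (hΩo : IsOpen Ω) (hΩb : Bornology.IsBounded Ω)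
    (α β : ℝ) (hα : 0 < α) (σ κ : ℝ) :
    ∃ c C : ℝ, 0 < c ∧ 0 < C ∧
      ∀ A : EuclideanSpace ℝ (Fin d) → ℝ,
        AEStronglyMeasurable A (volume.restrict Ω) →
        (∀ᵐ x ∂volume.restrict Ω, α ≤ A x ∧ A x ≤ β) →
      ∀ (T : LOD.RectMesh Ω) (H : ℝ), 0 < H → T.ShapeRegular σ → T.QuasiUniform κ H →
      ∀ G ∈ T.cells, ∀ v : LOD.L2 Ω,
        (∃! ψ : LOD.L2Pair Ω, T.IsEnrichedCorrection p A G v ψ) ∧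
        ∀ ψ : LOD.L2Pair Ω, T.IsEnrichedCorrection p A G v ψ →
          ∀ k : ℕ, 1 ≤ k →
            LOD.gradNormOn (Ω \ T.patch k G.closed) ψ
              ≤ C * Real.exp (-c * k) * LOD.gradNormOn Ω ψ := by
  obtain ⟨c, C, hc, hC, h⟩ := mainTheorem4_general d p Ω α β hα σ κ
  exact ⟨c, C, hc, hC, fun A hAm hAb T H hH hσ hκ G hG v =>
    (h A hAm hAb T H hH hσ hκ G hG v).imp_right fun hdecay ψ hψ k _ => hdecay ψ hψ k⟩
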